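/- Let $\gamma>1$ and $r\in\mathcal I_0=(-1,2\gamma-1)$. Let $M_\gamma=\{(\zeta_1,\zeta_2)\in\mathbb C^2:\operatorname{Im}\zeta_2=|\zeta_1|^\gamma\}$ and $\Omega_\gamma=\{(z_1,z_2)\in\mathbb C^2:\operatorname{Im}z_2>|z_1|^\gamma\}$. With the coordinates $\zeta=(\alpha e^{i\theta},s+i\alpha^\gamma)$ on $M_\gamma$ ($\alpha>0$, $\theta\in[0,2\pi)$, $s\in\mathbb R$), let $\mu_r=\alpha^r\,d\alpha\,d\theta\,ds$ and $\sigma=\mu_{\gamma-1}$. The Leray transform $\boldsymbol L$ of $M_\gamma$ assigns to $f\in L^2(M_\gamma,\mu_r)$ the function on $\Omega_\gamma$ given by the absolutely convergent integral $$\boldsymbol Lf(z)=\frac{\gamma^2}{4\pi^2}\int_{M_\gamma}\frac{f(\zeta)\,\sigma(\zeta)}{\big[\gamma\bar\zeta_1|\zeta_1|^{\gamma-2}(\zeta_1-z_1)+i(\zeta_2-z_2)\big]^2},\qquad z\in\Omega_\gamma,$$ and, on $M_\gamma$, its boundary value, i.e. the limit in $L^2(M_\gamma,\mu_r)$, as $\varepsilon\downarrow0$,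 of $\zeta\mapsto\boldsymbol Lf(\zeta_1,\zeta_2+i\varepsilon)$. This defines a bounded operator $\boldsymbol L$ on $L^2(M_\gamma,\mu_r)$. Let $\boldsymbol L^{*}$ be its adjoint in $L^2(M_\gamma,\mu_r)$ and put $\boldsymbol A=\boldsymbol L^{*}-\boldsymbol L$. For integers $k\ge0$ let $$C_{\mu_r}(\gamma,k)=\frac{\Gamma\big(\frac{2k+1+r}{\gamma}\big)\,\Gamma\big(2k+2-\frac{2k+1+r}{\gamma}\big)}{\Gamma(k+1)^2}\Big(\frac{\gamma}{2}\Big)^{2k+2}(\gamma-1)^{-\left(2k+2-\frac{2k+1+r}{\gamma}\right)} .$$ Then $C_{\mu_r}(\gamma,k)\ge1$ for all $k\ge 0$, the space $L^2(M_\gamma,\mu_r)$ has an orthonormal basis consisting of eigenfunctions of $\boldsymbol A$, the set of eigenvalues of $\boldsymbol A$ is exactly $$\{0\}\cup\Big\{\pm i\sqrt{C_{\mu_r}(\gamma,k)-1}\;:\;k=0,1,2,\dots\Big\},$$ and the spectrum of the bounded operator $\boldsymbol A$ is the closure of this set in $\mathbb C$. -/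

import Mathlib

open MeasureTheory Filter Topology

noncomputable section

namespace Leray

/-- The model hypersurface `M_γ = {(ζ₁, ζ₂) ∈ ℂ² : Im ζ₂ = |ζ₁| ^ γ}`. -/
def surface (γ : ℝ) : Set (ℂ × ℂ) := {ζ | ζ.2.im = ‖ζ.1‖ ^ γ}

/-- The unbounded domain `Ω_γ = {(z₁, z₂) ∈ ℂ² : Im z₂ > |z₁| ^ γ}` with boundary `M_γ`. -/
def domain (γ : ℝ) : Set (ℂ × ℂ) := {z | ‖z.1‖ ^ γ < z.2.im}

/-- The parametrization `(α, θ, s) ↦ (α e^{iθ}, s + i α ^ γ)` of `M_γ`. Only `α > 0` matters, since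
the measures below are carried by `α > 0`; the absolute value makes the map total. -/
def param (γ : ℝ) (p : ℝ × ℝ × ℝ) : surface γ :=
  ⟨((p.1 : ℂ) * Complex.exp (Complex.I * (p.2.1 : ℂ)),
      (p.2.2 : ℂ) + Complex.I * ((|p.1| ^ γ : ℝ) : ℂ)), by
    simp [surface, Complex.norm_exp]⟩

/-- The parametrization is measurable, so that the push-forward below is the intended one. -/
theorem measurable_param (γ : ℝ) : Measurable (param γ) := by
  unfold param
  refine Measurable.subtype_mk ?_
  have h : Measurable fun p : ℝ × ℝ × ℝ => |p.1| ^ γ :=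
    (continuous_abs.measurable.comp measurable_fst).pow_const γ
  fun_prop

/-- The measure `μ_r = α ^ r dα dθ ds` on `M_γ`, with `α = |ζ₁| > 0`, `θ = arg ζ₁ ∈ [0, 2π)` and
`s = Re ζ₂ ∈ ℝ`. -/
def mu (γ r : ℝ) : Measure (surface γ) :=
  Measure.map (param γ)
    (((volume.restrict (Set.Ioi (0 : ℝ))).withDensity fun α => ENNReal.ofReal (α ^ r)).prod
      ((volume.restrict (Set.Ico (0 : ℝ) (2 * Real.pi))).prod volume))

/-- The Hilbert space `L²(M_γ, μ_r)` of complex-valued functions. -/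
abbrev L2 (γ r : ℝ) : Type := Lp ℂ 2 (mu γ r)

/-- The Leray kernel of `M_γ`, as a density with respect to `σ = μ_{γ-1}`:
`(γ² / 4π²) / [γ conj(ζ₁) |ζ₁| ^ (γ-2) (ζ₁ - z₁) + i (ζ₂ - z₂)]²`. -/
def kernel (γ : ℝ) (z : ℂ × ℂ) (ζ : surface γ) : ℂ :=
  ((γ ^ 2 / (4 * Real.pi ^ 2) : ℝ) : ℂ) /
    ((γ : ℂ) * (starRingEnd ℂ) ζ.1.1 * ((‖ζ.1.1‖ ^ (γ - 2) : ℝ) : ℂ) * (ζ.1.1 - z.1)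
      + Complex.I * (ζ.1.2 - z.2)) ^ 2

/-- The Leray integral of a function `f` on `M_γ`, evaluated at `z`. -/
def lerayIntegral (γ : ℝ) (f : surface γ → ℂ) (z : ℂ × ℂ) : ℂ :=
  ∫ ζ, f ζ * kernel γ z ζ ∂(mu γ (γ - 1))

/-- `L` is the Leray transform of `M_γ`, as a bounded operator on `L²(M_γ, μ_r)`: for each `f` the
Leray integral converges absolutely at all points of `Ω_γ`, and `L f` is the boundary value
on `M_γ` of the function on `Ω_γ` that it defines, that is, the limit in `L²(M_γ, μ_r)`, as `ε ↓ 0`,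
of its vertical translates `ζ ↦ (Leray integral of f)(ζ₁, ζ₂ + i ε)`. (At points of `M_γ` itself
the kernel is too singular for absolute convergence.) -/
structure IsLerayTransform (γ r : ℝ) (L : L2 γ r →L[ℂ] L2 γ r) : Prop where
  integrable : ∀ f : L2 γ r, ∀ z ∈ domain γ,
    Integrable (fun ζ => f ζ * kernel γ z ζ) (mu γ (γ - 1))
  tendsto : ∀ f : L2 γ r,
    Tendsto
      (fun ε : ℝ => eLpNorm
        (fun ζ : surface γ => lerayIntegral γ f (ζ.1.1, ζ.1.2 + Complex.I * (ε : ℂ)) - L f ζ) 2 (mu γ r))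
      (𝓝[>] 0) (𝓝 0)

/-- The `μ_r`-symbol function `C_{μ_r}(γ, k)`. -/
def symbol (γ r : ℝ) (k : ℕ) : ℝ :=
  Real.Gamma ((2 * k + 1 + r) / γ) * Real.Gamma (2 * k + 2 - (2 * k + 1 + r) / γ)
    / Real.Gamma (k + 1) ^ 2 * (γ / 2) ^ (2 * k + 2)
    * (γ - 1) ^ (-(2 * k + 2 - (2 * k + 1 + r) / γ))

/-- The set `{0} ∪ {± i √(C_{μ_r}(γ, k) - 1) : k = 0, 1, 2, …}`. -/
def eigenvalueSet (γ r : ℝ) : Set ℂ :=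
  {0} ∪ {c | ∃ k : ℕ, c = Complex.I * (Real.sqrt (symbol γ r k - 1) : ℂ) ∨
    c = -(Complex.I * (Real.sqrt (symbol γ r k - 1) : ℂ))}

end Leray

end

noncomputable section

namespace Leray

/-! ### Skew-adjoint operators with a dense span of eigenvectors -/

section

open scoped InnerProductSpace
open ContinuousLinearMap (adjoint)

section Skew

variable {H : Type} [NormedAddCommGroup H] [InnerProductSpace ℂ H] [CompleteSpace H]

/-! In polar coordinates the Leray transform is diagonal under Fourier series in `θ` and Fourier
transform in `s`. On `M_γ` the denominator of the kernel is the square of `A - B`, where `A =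
(γ-1)α^γ + i(s - z₂)` and `B` is linear in `z₁` and carries one factor `e^{-iθ}`. Young's inequality
gives `‖B‖ ≤ c‖A‖` with `c < 1` uniformly in `ζ`, so the kernel is the dominated series of the terms
`(k+1) B^k / A^(k+2)`, and `(k+1)! / A^(k+2) = ∫ ξ^(k+1) e^{-Aξ} dξ` over `ξ > 0`.

Hence at angular frequency `k ≥ 0` and frequency `ξ > 0` the transform has rank one in the radial
variable: it pairs with `α^((k+1)(γ-1)-r) e^{-(γ-1)ξα^γ}` in `L²(α^r dα)` and returns a multiple of
`α^k e^{-ξα^γ}`. After normalization these profiles give isometries `Ψ k` and `Φ k` from `L²(0,∞)`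
into `L²(μ_r)`, with `(Φ k)†(Ψ k) = κ k` a scalar independent of `ξ`, and `L = ∑ (κ k)⁻¹ Φ k (Ψ k)†`
is an oblique projection (`inv_pairCoeff_mul_conj_synth_probe`, `isLerayTransform`). Gamma integrals
give `(κ k)⁻² = C_{μ_r}(γ,k)` (`inv_pairCoeff_sq`); Cauchy–Schwarz makes it at least `1`, and
Stirling makes it bounded in `k` (`exists_symbol_le`), so `L` is bounded.

The operator `L† - L` preserves the span of `Φ k g` and `Ψ k g`, where its square is `1 - (κ k)⁻²`;
this yields the eigenvalues `±i√(C-1)`. It vanishes on the orthogonal complement of all these spans,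
which contains the functions of negative angular frequency, so `0` is an eigenvalue too
(`IsBiorthogonal.eigenvalues_skew`). Eigenvectors being total, the operator is diagonal in an
orthonormal basis, and its spectrum is the closure of its eigenvalues (`spectrum_of_skew`). -/

theorem inner_map_of_skew {A : H →L[ℂ] H} (hA : adjoint A = -A) (v w : H) :
    ⟪A v, w⟫_ℂ = -⟪v, A w⟫_ℂ := by
  rw [← ContinuousLinearMap.adjoint_inner_right, hA]
  simp

theorem conj_eigenvalue_of_skew {A : H →L[ℂ] H} (hA : adjoint A = -A) {c : ℂ} {w : H}
    (hw : w ≠ 0) (h : A w = c • w) : (starRingEnd ℂ) c = -c := by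
  have h1 := inner_map_of_skew hA w w
  rw [h, inner_smul_left, inner_smul_right, ← neg_mul] at h1
  exact mul_right_cancel₀ (by simpa using hw) h1

theorem inner_eigenvector_of_skew {A : H →L[ℂ] H} (hA : adjoint A = -A) {c d : ℂ} {v w : H}
    (hcd : c ≠ d) (hv : A v = c • v) (hw : A w = d • w) : ⟪v, w⟫_ℂ = 0 := by
  rcases eq_or_ne v 0 with rfl | hv0
  · simp
  have h1 := inner_map_of_skew hA v w
  rw [hv, hw, inner_smul_left, inner_smul_right, conj_eigenvalue_of_skew hA hv0 hv] at h1
  have : (c - d) * ⟪v, w⟫_ℂ = 0 := by linear_combination -h1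
  simpa [sub_eq_zero, hcd] using this

theorem orthogonalFamily_eigenspace_of_skew {A : H →L[ℂ] H} (hA : adjoint A = -A) :
    OrthogonalFamily ℂ (fun c : ℂ => Module.End.eigenspace (A : H →ₗ[ℂ] H) c)
      fun c => (Module.End.eigenspace (A : H →ₗ[ℂ] H) c).subtypeₗᵢ := by
  intro c d hcd v w
  exact inner_eigenvector_of_skew hA hcd (Module.End.mem_eigenspace_iff.1 v.2)
    (Module.End.mem_eigenspace_iff.1 w.2)

/-- Eigenspaces of a skew-adjoint operator are closed and mutually orthogonal, so orthonormal bases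
of all of them can be glued; totality of the eigenvectors (`hd`) makes the union complete. -/
theorem exists_hilbertBasis_of_skew {A : H →L[ℂ] H} (hA : adjoint A = -A)
    (hd : ∀ v : H, (∀ (c : ℂ) (w : H), A w = c • w → ⟪w, v⟫_ℂ = 0) → v = 0) :
    ∃ (ι : Type) (b : HilbertBasis ι ℂ H), ∀ i, ∃ c : ℂ, A (b i) = c • b i := by
  have hc : ∀ c : ℂ, CompleteSpace (Module.End.eigenspace (A : H →ₗ[ℂ] H) c) := by
    intro c
    have : IsClosed ((Module.End.eigenspace (A : H →ₗ[ℂ] H) c : Submodule ℂ H) : Set H) := by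
      have : ((Module.End.eigenspace (A : H →ₗ[ℂ] H) c : Submodule ℂ H) : Set H)
          = {v | A v = c • v} := by
        ext v; simp
      rw [this]
      exact isClosed_eq A.continuous (continuous_const_smul c)
    exact this.completeSpace_coe
  choose w b hb using fun c : ℂ =>
    exists_hilbertBasis ℂ (Module.End.eigenspace (A : H →ₗ[ℂ] H) c)
  have hon := (orthogonalFamily_eigenspace_of_skew hA).orthonormal_sigma_orthonormal
    (fun c => (b c).orthonormal)
  have heig : ∀ i : Σ c, w c, A (b i.1 i.2 : H) = i.1 • (b i.1 i.2 : H) := fun i =>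
    Module.End.mem_eigenspace_iff.1 (b i.1 i.2).2
  refine ⟨Σ c, w c, HilbertBasis.mkOfOrthogonalEqBot hon ?_, ?_⟩
  · rw [Submodule.eq_bot_iff]
    intro v hv
    refine hd v fun c x hx => ?_
    rw [Submodule.mem_orthogonal] at hv
    have hxm : x ∈ Module.End.eigenspace (A : H →ₗ[ℂ] H) c := Module.End.mem_eigenspace_iff.2 hx
    have hs := ((b c).hasSum_repr ⟨x, hxm⟩).mapL
      (Module.End.eigenspace (A : H →ₗ[ℂ] H) c).subtypeL
    have hz : ∀ i, ⟪v, (Module.End.eigenspace (A : H →ₗ[ℂ] H) c).subtypeL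
        ((b c).repr ⟨x, hxm⟩ i • b c i)⟫_ℂ = 0 := by
      intro i
      have := hv _ (Submodule.subset_span ⟨⟨c, i⟩, rfl⟩)
      rw [inner_eq_zero_symm] at this
      simpa [inner_smul_right] using Or.inr this
    have hs2 := hs.mapL (innerSL ℂ v)
    simp only [innerSL_apply_apply, hz] at hs2
    have := hs2.unique hasSum_zero
    rw [inner_eq_zero_symm]
    simpa using this
  · intro i
    exact ⟨i.1, by simpa using heig i⟩

omit [CompleteSpace H] in
theorem hasEigenvalue_iff_exists {A : H →L[ℂ] H} {c : ℂ} :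
    Module.End.HasEigenvalue (A : H →ₗ[ℂ] H) c ↔ ∃ v : H, v ≠ 0 ∧ A v = c • v := by
  constructor
  · intro h
    obtain ⟨v, hv⟩ := h.exists_hasEigenvector
    exact ⟨v, hv.2, Module.End.mem_eigenspace_iff.1 hv.1⟩
  · rintro ⟨v, hv, h⟩
    exact Module.End.hasEigenvalue_of_hasEigenvector (x := v)
      ⟨Module.End.mem_eigenspace_iff.2 h, hv⟩

omit [CompleteSpace H] in
theorem hasEigenvalue_mem_spectrum {A : H →L[ℂ] H} {c : ℂ}
    (hc : Module.End.HasEigenvalue (A : H →ₗ[ℂ] H) c) : c ∈ spectrum ℂ A := by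
  obtain ⟨v, hv, h⟩ := hasEigenvalue_iff_exists.1 hc
  rw [spectrum.mem_iff]
  rintro ⟨u, hu⟩
  apply hv
  have h1 : (u⁻¹.1 * u.1) v = v := by simp
  rw [← h1, hu, mul_apply_eq_comp]
  simp [Algebra.algebraMap_eq_smul_one, h]

-- The inverse is the diagonal operator with entries `(d i)⁻¹`, bounded by `δ⁻¹`.
omit [CompleteSpace H] in
theorem isUnit_of_hilbertBasis {ι : Type} (b : HilbertBasis ι ℂ H) {B : H →L[ℂ] H} {d : ι → ℂ}
    (hB : ∀ v i, b.repr (B v) i = d i * b.repr v i) {δ : ℝ} (hδ : 0 < δ) (hd : ∀ i, δ ≤ ‖d i‖) :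
    IsUnit B := by
  have hd0 : ∀ i, d i ≠ 0 := fun i h => by
    have := hd i
    simp [h] at this
    linarith
  have hbd : ∀ i, ‖(d i)⁻¹ • ContinuousLinearMap.id ℂ ℂ‖ ≤ δ⁻¹ := by
    intro i
    rw [norm_smul, ContinuousLinearMap.norm_id, mul_one, norm_inv]
    exact inv_anti₀ hδ (hd i)
  let D := lp.mapCLM 2 (fun i => (d i)⁻¹ • ContinuousLinearMap.id ℂ ℂ) (inv_pos.2 hδ).le hbd
  have hD : ∀ x i, D x i = (d i)⁻¹ * x i := fun x i => rfl
  let R : H →L[ℂ] H := (b.repr.symm : lp (fun _ : ι => ℂ) 2 →L[ℂ] H) ∘L D ∘L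
    (b.repr : H →L[ℂ] lp (fun _ : ι => ℂ) 2)
  have hR : ∀ v i, b.repr (R v) i = (d i)⁻¹ * b.repr v i := by
    intro v i
    simp [R, hD]
  refine isUnit_iff_exists.2 ⟨R, ?_, ?_⟩
  · ext v
    apply b.repr.injective
    ext i
    rw [mul_apply_eq_comp, hB, hR, ← mul_assoc, mul_inv_cancel₀ (hd0 i), one_mul]
    rfl
  · ext v
    apply b.repr.injective
    ext i
    rw [mul_apply_eq_comp, hR, hB, ← mul_assoc, inv_mul_cancel₀ (hd0 i), one_mul]
    rfl

/-- A point `z` at distance at least `δ > 0` from every eigenvalue makes `z - A` diagonal with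
entries bounded away from zero, hence invertible. Conversely eigenvalues lie in the spectrum, which
is closed. -/
theorem spectrum_of_skew {A : H →L[ℂ] H} (hA : adjoint A = -A) {ι : Type}
    (b : HilbertBasis ι ℂ H) (hb : ∀ i, ∃ c : ℂ, A (b i) = c • b i) :
    spectrum ℂ A = closure {c : ℂ | Module.End.HasEigenvalue (A : H →ₗ[ℂ] H) c} := by
  apply Set.Subset.antisymm
  · intro z hz
    by_contra hcl
    obtain ⟨δ, hδ, hball⟩ : ∃ δ > 0, ∀ c ∈ {c : ℂ | Module.End.HasEigenvalue (A : H →ₗ[ℂ] H) c},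
        δ ≤ dist z c := by
      simpa [Metric.mem_closure_iff] using hcl
    choose c hc using hb
    have hne : ∀ i, b i ≠ 0 := fun i => b.orthonormal.ne_zero i
    rw [spectrum.mem_iff] at hz
    refine hz (isUnit_of_hilbertBasis b (d := fun i => z - c i) ?_ hδ ?_)
    · intro v i
      -- Skew-adjointness transfers `A` onto `b i`, so the `i`-th coefficient of `A v` is `c i`
      -- times that of `v`.
      have h1 := inner_map_of_skew hA (b i) v
      rw [hc, inner_smul_left, conj_eigenvalue_of_skew hA (hne i) (hc i)] at h1
      simp only [HilbertBasis.repr_apply_apply, Algebra.algebraMap_eq_smul_one]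
      simp only [sub_apply, smul_apply,
        one_apply_eq_self, inner_sub_right, inner_smul_right]
      linear_combination -h1
    · intro i
      rw [← dist_eq_norm]
      exact hball _ (hasEigenvalue_iff_exists.2 ⟨b i, hne i, hc i⟩)
  · exact closure_minimal (fun c hc => hasEigenvalue_mem_spectrum hc) (spectrum.isClosed A)

end Skew

end

/-! ### Oblique projections along biorthogonal families -/

section

open scoped InnerProductSpace
open ContinuousLinearMap (adjoint)

section Biorthogonal

variable {H K : Type} [NormedAddCommGroup H] [InnerProductSpace ℂ H] [CompleteSpace H]
  [NormedAddCommGroup K] [InnerProductSpace ℂ K] [CompleteSpace K]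

/-- Two families of isometric embeddings, each with mutually orthogonal ranges, which pair
diagonally with positive coefficients `κ k` bounded away from zero. -/
structure IsBiorthogonal (Φ Ψ : ℕ → K →ₗᵢ[ℂ] H) (κ : ℕ → ℝ) : Prop where
  left : OrthogonalFamily ℂ (fun _ : ℕ => K) Φ
  right : OrthogonalFamily ℂ (fun _ : ℕ => K) Ψ
  inner_same : ∀ k g h, ⟪Φ k g, Ψ k h⟫_ℂ = κ k * ⟪g, h⟫_ℂ
  inner_ne : ∀ j k g h, j ≠ k → ⟪Φ j g, Ψ k h⟫_ℂ = 0
  pos : ∀ k, 0 < κ k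
  bounded : ∃ C, ∀ k, (κ k)⁻¹ ≤ C

namespace IsBiorthogonal

variable {Φ Ψ : ℕ → K →ₗᵢ[ℂ] H} {κ : ℕ → ℝ}

omit [CompleteSpace H] [CompleteSpace K] in
theorem symm (h : IsBiorthogonal Φ Ψ κ) : IsBiorthogonal Ψ Φ κ where
  left := h.right
  right := h.left
  inner_same k g g' := by
    rw [← inner_conj_symm, h.inner_same, map_mul, inner_conj_symm, Complex.conj_ofReal]
  inner_ne j k g g' hjk := by
    rw [inner_eq_zero_symm]
    exact h.inner_ne k j g' g hjk.symm
  pos := h.pos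
  bounded := h.bounded

/-- The diagonal operator with entries `(κ k)⁻¹`. -/
def diag (h : IsBiorthogonal Φ Ψ κ) :
    lp (fun _ : ℕ => K) 2 →L[ℂ] lp (fun _ : ℕ => K) 2 :=
  lp.mapCLM 2 (fun k => ((κ k : ℂ))⁻¹ • ContinuousLinearMap.id ℂ K)
    (K := h.bounded.choose) ((inv_pos.2 (h.pos 0)).le.trans (h.bounded.choose_spec 0))
    fun k => by
      refine le_trans (norm_smul_le _ _) ?_
      rw [norm_inv, Complex.norm_real, Real.norm_of_nonneg (h.pos k).le]
      refine le_trans ?_ (h.bounded.choose_spec k)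
      exact mul_le_of_le_one_right (inv_pos.2 (h.pos k)).le ContinuousLinearMap.norm_id_le

omit [CompleteSpace H] in
theorem diag_apply (h : IsBiorthogonal Φ Ψ κ) (x : lp (fun _ : ℕ => K) 2) (k : ℕ) :
    h.diag x k = ((κ k : ℂ))⁻¹ • x k := rfl

omit [CompleteSpace H] in
theorem inner_diag (h : IsBiorthogonal Φ Ψ κ) (x y : lp (fun _ : ℕ => K) 2) :
    ⟪h.diag x, y⟫_ℂ = ⟪x, h.diag y⟫_ℂ := by
  rw [lp.inner_eq_tsum, lp.inner_eq_tsum]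
  congr 1
  ext k
  simp [diag_apply, inner_smul_left, inner_smul_right]

/-- The operator `∑ (κ k)⁻¹ Φ k (Ψ k)†`. -/
def proj (h : IsBiorthogonal Φ Ψ κ) : H →L[ℂ] H :=
  h.left.linearIsometry.toContinuousLinearMap ∘L h.diag ∘L
    adjoint h.right.linearIsometry.toContinuousLinearMap

/-- The coefficients `κ k` are real, so taking the adjoint merely exchanges the two families. -/
theorem adjoint_proj (h : IsBiorthogonal Φ Ψ κ) : adjoint h.proj = h.symm.proj := by
  symm
  rw [ContinuousLinearMap.eq_adjoint_iff]
  intro x y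
  change ⟪h.right.linearIsometry.toContinuousLinearMap (h.diag
    (adjoint h.left.linearIsometry.toContinuousLinearMap x)), y⟫_ℂ
    = ⟪x, h.left.linearIsometry.toContinuousLinearMap (h.diag
    (adjoint h.right.linearIsometry.toContinuousLinearMap y))⟫_ℂ
  exact (ContinuousLinearMap.adjoint_inner_right _ _ _).symm.trans
    ((h.inner_diag _ _).trans (ContinuousLinearMap.adjoint_inner_left _ _ _))

theorem adjoint_linearIsometry_apply {V : ℕ → K →ₗᵢ[ℂ] H}
    (hV : OrthogonalFamily ℂ (fun _ : ℕ => K) V) (v : H) (k : ℕ) :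
    adjoint hV.linearIsometry.toContinuousLinearMap v k
      = adjoint (V k).toContinuousLinearMap v := by
  refine ext_inner_left ℂ fun g => ?_
  rw [ContinuousLinearMap.adjoint_inner_right]
  refine (lp.inner_single_left (𝕜 := ℂ) (G := fun _ : ℕ => K) k g _).symm.trans ?_
  rw [ContinuousLinearMap.adjoint_inner_right]
  simp

/-- The coefficients of `h.proj v`, as a square-summable sequence. -/
def coeff (h : IsBiorthogonal Φ Ψ κ) (v : H) : lp (fun _ : ℕ => K) 2 :=
  h.diag (adjoint h.right.linearIsometry.toContinuousLinearMap v)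

theorem coeff_apply (h : IsBiorthogonal Φ Ψ κ) (v : H) (k : ℕ) :
    h.coeff v k = ((κ k : ℂ))⁻¹ • adjoint (Ψ k).toContinuousLinearMap v := by
  rw [coeff, diag_apply, adjoint_linearIsometry_apply]

theorem proj_apply (h : IsBiorthogonal Φ Ψ κ) (v : H) :
    h.proj v = h.left.linearIsometry (h.coeff v) := rfl

theorem proj_eq_zero (h : IsBiorthogonal Φ Ψ κ) {v : H} (hv : ∀ k g, ⟪Ψ k g, v⟫_ℂ = 0) :
    h.proj v = 0 := by
  have : h.coeff v = 0 := by
    ext k : 2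
    rw [coeff_apply]
    have : adjoint (Ψ k).toContinuousLinearMap v = 0 := by
      refine ext_inner_left ℂ fun g => ?_
      rw [ContinuousLinearMap.adjoint_inner_right]
      simpa using hv k g
    simp [this]
  rw [proj_apply, this, map_zero]

theorem proj_of_coeff_eq (h : IsBiorthogonal Φ Ψ κ) {v : H} {k : ℕ} {g : K}
    (hk : adjoint (Ψ k).toContinuousLinearMap v = g)
    (hj : ∀ j, j ≠ k → adjoint (Ψ j).toContinuousLinearMap v = 0) :
    h.proj v = ((κ k : ℂ))⁻¹ • Φ k g := by
  have : h.coeff v = lp.single 2 k (((κ k : ℂ))⁻¹ • g) := by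
    ext j : 2
    rw [coeff_apply]
    rcases eq_or_ne j k with rfl | hjk
    · rw [hk]; simp
    · rw [hj j hjk, lp.single_apply_ne _ _ _ hjk, smul_zero]
  rw [proj_apply, this, OrthogonalFamily.linearIsometry_apply_single, map_smul]

theorem proj_left (h : IsBiorthogonal Φ Ψ κ) (k : ℕ) (g : K) : h.proj (Φ k g) = Φ k g := by
  have hκ : (κ k : ℂ) ≠ 0 := by exact_mod_cast (h.pos k).ne'
  rw [h.proj_of_coeff_eq (k := k) (g := (κ k : ℂ) • g), map_smul, smul_smul, inv_mul_cancel₀ hκ,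
    one_smul]
  · refine ext_inner_left ℂ fun g' => ?_
    rw [ContinuousLinearMap.adjoint_inner_right, inner_smul_right]
    exact h.symm.inner_same k g' g
  · intro j hj
    refine ext_inner_left ℂ fun g' => ?_
    rw [ContinuousLinearMap.adjoint_inner_right, inner_zero_right]
    exact h.symm.inner_ne j k g' g hj

theorem proj_right (h : IsBiorthogonal Φ Ψ κ) (k : ℕ) (g : K) :
    h.proj (Ψ k g) = ((κ k : ℂ))⁻¹ • Φ k g := by
  apply h.proj_of_coeff_eq
  · refine ext_inner_left ℂ fun g' => ?_
    rw [ContinuousLinearMap.adjoint_inner_right]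
    exact (Ψ k).inner_map_map g' g
  · intro j hj
    refine ext_inner_left ℂ fun g' => ?_
    rw [ContinuousLinearMap.adjoint_inner_right, inner_zero_right]
    exact h.right hj g' g

/-- The skew part `L† - L` of the oblique projection `L = ∑ (κ k)⁻¹ Φ k (Ψ k)†`. -/
def skew (h : IsBiorthogonal Φ Ψ κ) : H →L[ℂ] H := adjoint h.proj - h.proj

theorem skew_apply (h : IsBiorthogonal Φ Ψ κ) (v : H) :
    h.skew v = h.symm.proj v - h.proj v := by
  rw [skew, adjoint_proj]; rfl

theorem adjoint_skew (h : IsBiorthogonal Φ Ψ κ) : adjoint h.skew = -h.skew := by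
  rw [skew, map_sub, ContinuousLinearMap.adjoint_adjoint, neg_sub]

theorem skew_left (h : IsBiorthogonal Φ Ψ κ) (k : ℕ) (g : K) :
    h.skew (Φ k g) = ((κ k : ℂ))⁻¹ • Ψ k g - Φ k g := by
  rw [skew_apply, proj_left, proj_right]

theorem skew_right (h : IsBiorthogonal Φ Ψ κ) (k : ℕ) (g : K) :
    h.skew (Ψ k g) = Ψ k g - ((κ k : ℂ))⁻¹ • Φ k g := by
  rw [skew_apply, proj_left, proj_right]

-- Cauchy–Schwarz for `Φ k g` and `Ψ k g`, two vectors of equal norm. This is the source of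
-- `C_{μ_r}(γ,k) ≥ 1`.
omit [CompleteSpace H] [CompleteSpace K] in
theorem one_le_inv [Nontrivial K] (h : IsBiorthogonal Φ Ψ κ) (k : ℕ) : 1 ≤ (κ k)⁻¹ := by
  obtain ⟨g, hg⟩ := exists_ne (0 : K)
  have h1 := norm_inner_le_norm (𝕜 := ℂ) (Φ k g) (Ψ k g)
  rw [h.inner_same, LinearIsometry.norm_map, LinearIsometry.norm_map, norm_mul,
    Complex.norm_real, Real.norm_of_nonneg (h.pos k).le, inner_self_eq_norm_sq_to_K, norm_pow,
    RCLike.norm_ofReal, abs_norm] at h1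
  have : 0 < ‖g‖ ^ 2 := by positivity
  exact (one_le_inv₀ (h.pos k)).2 (by nlinarith)

/-- On the pair `Φ k g`, `Ψ k g` the operator acts by a matrix of trace `0` and determinant `(κ k)⁻²
- 1`, so its eigenvalues are the square roots of `1 - (κ k)⁻²`. The vector given may vanish;
`hasEigenvalue_skew` deals with that. -/
theorem skew_eigenvector (h : IsBiorthogonal Φ Ψ κ) {k : ℕ} {c : ℂ}
    (hc : c ^ 2 = 1 - ((κ k : ℂ)⁻¹) ^ 2) (g : K) :
    h.skew (-(κ k : ℂ)⁻¹ • Φ k g + (c + 1) • Ψ k g)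
      = c • (-(κ k : ℂ)⁻¹ • Φ k g + (c + 1) • Ψ k g) := by
  rw [map_add, map_smul, map_smul, skew_left, skew_right]
  match_scalars
  · linear_combination -hc
  · ring

-- The equality case of Cauchy–Schwarz: `‖Φ k g - Ψ k g‖² = 0` on expanding.
omit [CompleteSpace H] [CompleteSpace K] in
theorem left_eq_right (h : IsBiorthogonal Φ Ψ κ) {k : ℕ} (hk : κ k = 1) (g : K) :
    Φ k g = Ψ k g := by
  rw [← sub_eq_zero, ← inner_self_eq_zero (𝕜 := ℂ), inner_sub_left, inner_sub_right,
    inner_sub_right, h.inner_same, h.symm.inner_same, LinearIsometry.inner_map_map,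
    LinearIsometry.inner_map_map, hk]
  simp

theorem hasEigenvalue_skew [Nontrivial K] (h : IsBiorthogonal Φ Ψ κ) {k : ℕ} {c : ℂ}
    (hc : c ^ 2 = 1 - ((κ k : ℂ)⁻¹) ^ 2) :
    Module.End.HasEigenvalue (h.skew : H →ₗ[ℂ] H) c := by
  obtain ⟨g, hg⟩ := exists_ne (0 : K)
  have hκ : (κ k : ℂ) ≠ 0 := by exact_mod_cast (h.pos k).ne'
  have hgg : ⟪g, g⟫_ℂ ≠ 0 := by simpa using hg
  rw [hasEigenvalue_iff_exists]
  -- For `κ k = 1` the two embeddings coincide and the general eigenvector degenerates to zero, so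
  -- `Φ k g` itself serves.
  by_cases hk : κ k = 1
  · have hc0 : c = 0 := by simpa [hk] using hc
    refine ⟨Φ k g, ?_, ?_⟩
    · exact fun h0 => hg ((Φ k).injective (by simpa using h0))
    · rw [skew_left, h.left_eq_right hk, hk, hc0]; simp
  · refine ⟨_, ?_, h.skew_eigenvector hc g⟩
    intro h0
    -- If the eigenvector vanished, pairing with `Φ k g` would give `c + 1 = (κ k)⁻² = 1 - c²`, so
    -- `c = 0` or `c = -1`; the first forces `κ k = 1`, the second `(κ k)⁻¹ = 0`.
    have h1 := congrArg (fun v => ⟪Φ k g, v⟫_ℂ) h0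
    simp only [inner_add_right, inner_smul_right, inner_zero_right, h.inner_same,
      LinearIsometry.inner_map_map] at h1
    have h2 : (-(κ k : ℂ)⁻¹ + (c + 1) * κ k) = 0 := by
      apply mul_right_cancel₀ hgg
      linear_combination h1
    have h3 : c + 1 = ((κ k : ℂ)⁻¹) ^ 2 := by
      field_simp at h2 ⊢
      linear_combination h2
    have h4 : c * (c + 1) = 0 := by linear_combination hc + h3
    rcases mul_eq_zero.1 h4 with h5 | h5
    · rw [h5, zero_add] at h3
      have : ((κ k)⁻¹) ^ 2 = 1 := by exact_mod_cast h3.symm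
      have h6 : (κ k)⁻¹ = 1 := (pow_eq_one_iff_of_nonneg (inv_pos.2 (h.pos k)).le two_ne_zero).1 this
      exact hk (inv_eq_one.1 h6)
    · rw [h5] at h3
      exact (pow_ne_zero 2 (inv_ne_zero hκ)) h3.symm

/-- The eigenvectors for the two roots `±c` span both `Φ k g` and `Ψ k g` when `κ k ≠ 1`, so
orthogonality to them is orthogonality to both ranges. The lemma serves twice: for totality of the
eigenvectors and to exclude further eigenvalues. -/
theorem skew_eq_zero_of_inner_eq_zero (h : IsBiorthogonal Φ Ψ κ) {v : H}
    (hv : ∀ (k : ℕ) (c : ℂ), c ^ 2 = 1 - ((κ k : ℂ)⁻¹) ^ 2 → ∀ w, h.skew w = c • w →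
      ⟪w, v⟫_ℂ = 0) : h.skew v = 0 := by
  have key : ∀ k g, ⟪Φ k g, v⟫_ℂ = 0 ∧ ⟪Ψ k g, v⟫_ℂ = 0 := by
    intro k g
    have hκ : (κ k : ℂ) ≠ 0 := by exact_mod_cast (h.pos k).ne'
    by_cases hk : κ k = 1
    · have : ⟪Φ k g, v⟫_ℂ = 0 := by
        refine hv k 0 (by simp [hk]) _ ?_
        rw [skew_left, h.left_eq_right hk, hk]; simp
      exact ⟨this, h.left_eq_right hk g ▸ this⟩
    · obtain ⟨c, hc⟩ : ∃ c : ℂ, c ^ 2 = 1 - ((κ k : ℂ)⁻¹) ^ 2 :=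
        IsAlgClosed.exists_pow_nat_eq _ two_pos
      have hc0 : c ≠ 0 := by
        rintro rfl
        have h1 : ((κ k : ℂ)⁻¹) ^ 2 = 1 := by linear_combination hc
        have : ((κ k)⁻¹) ^ 2 = 1 := by exact_mod_cast h1
        have h6 := (pow_eq_one_iff_of_nonneg (inv_pos.2 (h.pos k)).le two_ne_zero).1 this
        exact hk (inv_eq_one.1 h6)
      have h1 := hv k c hc _ (h.skew_eigenvector hc g)
      have h2 := hv k (-c) (by rw [neg_sq, hc]) _ (h.skew_eigenvector (by rw [neg_sq, hc]) g)
      simp only [inner_add_left, inner_smul_left, map_add, map_neg, map_one] at h1 h2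
      have hcc : (starRingEnd ℂ) c ≠ 0 := by simpa using hc0
      have h3 : ⟪Ψ k g, v⟫_ℂ = 0 := by
        have : (2 * (starRingEnd ℂ) c) * ⟪Ψ k g, v⟫_ℂ = 0 := by linear_combination h1 - h2
        simpa [hcc] using this
      refine ⟨?_, h3⟩
      rw [h3] at h1
      simpa [hκ] using h1
  rw [skew_apply, h.proj_eq_zero fun k g => (key k g).2,
    h.symm.proj_eq_zero fun k g => (key k g).1, sub_zero]

theorem exists_hilbertBasis_skew (h : IsBiorthogonal Φ Ψ κ) :
    ∃ (ι : Type) (b : HilbertBasis ι ℂ H), ∀ i, ∃ c : ℂ, h.skew (b i) = c • b i := by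
  refine exists_hilbertBasis_of_skew h.adjoint_skew fun v hv => ?_
  have h0 : h.skew v = 0 := h.skew_eq_zero_of_inner_eq_zero fun _ c _ w hw => hv c w hw
  -- A vector orthogonal to all eigenvectors lies in the kernel, so it is an eigenvector for `0` and
  -- orthogonal to itself.
  exact inner_self_eq_zero.1 (hv 0 v (by simpa using h0))

theorem eigenvalues_skew [Nontrivial K] (h : IsBiorthogonal Φ Ψ κ)
    (h0 : ∃ v : H, v ≠ 0 ∧ ∀ k g, ⟪Φ k g, v⟫_ℂ = 0 ∧ ⟪Ψ k g, v⟫_ℂ = 0) :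
    {c : ℂ | Module.End.HasEigenvalue (h.skew : H →ₗ[ℂ] H) c}
      = {0} ∪ {c | ∃ k, c ^ 2 = 1 - ((κ k : ℂ)⁻¹) ^ 2} := by
  ext c
  simp only [Set.mem_ofPred_eq, Set.singleton_union, Set.mem_insert_iff]
  constructor
  · intro hc
    by_contra! hn
    obtain ⟨v, hv, hcv⟩ := hasEigenvalue_iff_exists.1 hc
    -- An eigenvector for any other value would be orthogonal to all the block eigenvectors, hence
    -- in the kernel, although its eigenvalue is nonzero.
    have := h.skew_eq_zero_of_inner_eq_zero (v := v) fun k d hd w hw =>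
      inner_eigenvector_of_skew h.adjoint_skew (fun hdc => hn.2 k (by rw [← hdc, hd])) hw hcv
    rw [hcv] at this
    exact (smul_ne_zero hn.1 hv) this
  · rintro (rfl | ⟨k, hk⟩)
    · obtain ⟨v, hv, hv'⟩ := h0
      refine hasEigenvalue_iff_exists.2 ⟨v, hv, ?_⟩
      rw [skew_apply, h.proj_eq_zero fun k g => (hv' k g).2,
        h.symm.proj_eq_zero fun k g => (hv' k g).1]
      simp
    · exact h.hasEigenvalue_skew hk

end IsBiorthogonal
end Biorthogonal

end

/-! ### The Fourier integral on `L¹ ∩ L²` -/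

section

open scoped InnerProductSpace FourierTransform SchwartzMap

/-- On `L¹ ∩ L²` the Fourier transform on `L²` is given by the Fourier integral. -/
theorem coeFn_fourier_toLp {u : ℝ → ℂ} (h1 : Integrable u) (h2 : MemLp u 2) :
    ((𝓕 (h2.toLp u) : Lp ℂ 2 (volume : Measure ℝ)) : ℝ → ℂ) =ᵐ[volume] 𝓕 u := by
  apply ae_eq_of_integral_contDiff_smul_eq
  · exact (Lp.memLp _).locallyIntegrable (by norm_num)
  · exact (VectorFourier.fourierIntegral_continuous Real.continuous_fourierChar
      (by fun_prop) h1).locallyIntegrable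
  · intro g hg hgc
    have hg₁ : HasCompactSupport (Complex.ofRealCLM ∘ g) := hgc.comp_left rfl
    have hg₂ : ContDiff ℝ ((⊤ : ℕ∞) : WithTop ℕ∞) (Complex.ofRealCLM ∘ g) := by fun_prop
    set G : 𝓢(ℝ, ℂ) := hg₁.toSchwartzMap hg₂
    have hG : ∀ x, G x = (g x : ℂ) := fun x => rfl
    -- Both sides are tested against a smooth compactly supported `G`. The `L²` transform agrees
    -- with the distributional one, which moves `𝓕` onto `G`; the multiplication formula for
    -- integrable functions moves it back onto `u`.
    have e1 := congrArg (fun T => T G) (Lp.fourier_toTemperedDistribution_eq (h2.toLp u))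
    simp only [TemperedDistribution.fourier_apply, Lp.toTemperedDistribution_apply] at e1
    have e2 : ∫ x, (𝓕 G) x • (h2.toLp u) x = ∫ x, (𝓕 G) x • u x := by
      apply integral_congr_ae
      filter_upwards [h2.coeFn_toLp] with x hx
      rw [hx]
    have e3 : ∫ x, (𝓕 G) x • u x = ∫ x, G x • 𝓕 u x := by
      have := VectorFourier.integral_fourierIntegral_smul_eq_flip (μ := (volume : Measure ℝ))
        (ν := (volume : Measure ℝ)) (f := G) (g := u) (e := Real.fourierChar)
        (L := innerₗ ℝ) Real.continuous_fourierChar (by fun_prop) G.integrable h1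
      rw [flip_innerₗ] at this
      rw [SchwartzMap.fourier_coe]
      exact this
    have e4 : ∀ w : ℝ → ℂ, ∫ x, g x • w x = ∫ x, G x • w x := by
      intro w
      congr 1
    rw [e4, e4, ← e1, e2, e3]

/-- The integral `∫ u(ξ) e^{iξs} dξ`. -/
def fint (u : ℝ → ℂ) (s : ℝ) : ℂ := ∫ ξ, u ξ * Complex.exp (Complex.I * ξ * s)

theorem fint_eq (u : ℝ → ℂ) (s : ℝ) : fint u s = 𝓕 u ((-(2 * Real.pi)⁻¹) * s) := by
  rw [fint, Real.fourier_real_eq_integral_exp_smul]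
  congr 1
  ext ξ
  rw [smul_eq_mul, mul_comm]
  congr 2
  push_cast
  field_simp

theorem continuous_fint {u : ℝ → ℂ} (h1 : Integrable u) : Continuous (fint u) := by
  have : Continuous (𝓕 u) := VectorFourier.fourierIntegral_continuous Real.continuous_fourierChar
      (by fun_prop) h1
  have h := this.comp (continuous_const_mul (-(2 * Real.pi)⁻¹))
  have e : fint u = 𝓕 u ∘ fun s => (-(2 * Real.pi)⁻¹) * s := by
    ext s; exact fint_eq u s
  rwa [e]

/-- Plancherel; the factor `2π` is the Jacobian of the rescaling in `fint_eq`. -/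
theorem integral_conj_fint_mul_fint {u v : ℝ → ℂ} (hu1 : Integrable u) (hu2 : MemLp u 2)
    (hv1 : Integrable v) (hv2 : MemLp v 2) :
    ∫ s, (starRingEnd ℂ) (fint u s) * fint v s
      = 2 * Real.pi * ∫ ξ, (starRingEnd ℂ) (u ξ) * v ξ := by
  have h := Lp.inner_fourier_eq (hu2.toLp u) (hv2.toLp v)
  rw [L2.inner_def, L2.inner_def] at h
  simp_rw [fint_eq]
  rw [Measure.integral_comp_mul_left (fun s => (starRingEnd ℂ) (𝓕 u s) * 𝓕 v s)]
  have e1 : ∫ s, (starRingEnd ℂ) (𝓕 u s) * 𝓕 v s = ∫ ξ, (starRingEnd ℂ) (u ξ) * v ξ := by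
    calc _ = ∫ a, ⟪(𝓕 (hu2.toLp u) : Lp ℂ 2 (volume : Measure ℝ)) a,
          (𝓕 (hv2.toLp v) : Lp ℂ 2 (volume : Measure ℝ)) a⟫_ℂ := by
          apply integral_congr_ae
          filter_upwards [coeFn_fourier_toLp hu1 hu2, coeFn_fourier_toLp hv1 hv2] with x h1 h2
          rw [h1, h2, RCLike.inner_apply, mul_comm]
      _ = _ := h
      _ = _ := by
          apply integral_congr_ae
          filter_upwards [hu2.coeFn_toLp, hv2.coeFn_toLp] with x h1 h2
          rw [h1, h2, RCLike.inner_apply, mul_comm]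
  rw [e1, inv_neg, inv_inv, abs_neg, abs_of_pos (by positivity)]
  simp

theorem memLp_fint {u : ℝ → ℂ} (hu1 : Integrable u) (hu2 : MemLp u 2) : MemLp (fint u) 2 := by
  have h : MemLp (𝓕 u) 2 := (memLp_congr_ae (coeFn_fourier_toLp hu1 hu2)).1 (Lp.memLp _)
  have hc : (-(2 * Real.pi)⁻¹) ≠ 0 := by
    have := Real.pi_pos
    exact neg_ne_zero.2 (inv_ne_zero (by positivity))
  rw [memLp_two_iff_integrable_sq_norm (continuous_fint hu1).aestronglyMeasurable]
  simp_rw [fint_eq]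
  exact ((memLp_two_iff_integrable_sq_norm h.1).1 h).comp_mul_left' hc

theorem lintegral_enorm_fint_sq {u : ℝ → ℂ} (hu1 : Integrable u) (hu2 : MemLp u 2) :
    ∫⁻ s, ‖fint u s‖ₑ ^ 2 = ENNReal.ofReal (2 * Real.pi) * ∫⁻ ξ, ‖u ξ‖ₑ ^ 2 := by
  have key : ∀ w : ℝ → ℂ, MemLp w 2 →
      ∫⁻ s, ‖w s‖ₑ ^ 2 = ENNReal.ofReal (∫ s, ‖w s‖ ^ 2) := by
    intro w hw
    rw [ofReal_integral_eq_lintegral_ofReal ((memLp_two_iff_integrable_sq_norm hw.1).1 hw)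
      (ae_of_all _ fun _ => by positivity)]
    congr 1
    ext s
    rw [ENNReal.ofReal_pow (norm_nonneg _), ofReal_norm]
  rw [key _ (memLp_fint hu1 hu2), key _ hu2, ← ENNReal.ofReal_mul (by positivity)]
  congr 1
  have h := integral_conj_fint_mul_fint hu1 hu2 hu1 hu2
  simp_rw [RCLike.conj_mul] at h
  have e : ∀ w : ℝ → ℂ, ∫ s, ((‖w s‖ : ℂ)) ^ 2 = ((∫ s, ‖w s‖ ^ 2 : ℝ) : ℂ) := by
    intro w
    rw [← integral_complex_ofReal]
    push_cast
    rfl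
  erw [e, e] at h
  exact_mod_cast h

end

/-! ### Boundedness of the symbol function -/

section

open Real (Gamma)

/-- Stirling's upper bound for `Γ` away from the origin. -/
theorem exists_gamma_le : ∃ C : ℝ, 0 < C ∧ ∀ x : ℝ, 1 ≤ x →
    Gamma x ≤ C * (x ^ (x - 1 / 2) * Real.exp (-x)) := by
  -- `n! ≤ C √n (n/e)^n`
  obtain ⟨C, hC, hfac⟩ : ∃ C : ℝ, 0 < C ∧ ∀ n : ℕ, 1 ≤ n →
      (n.factorial : ℝ) ≤ C * ((n : ℝ) ^ ((n : ℝ) + 1 / 2) * Real.exp (-n)) := by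
    -- The Stirling sequence decreases from its first term `e/√2`, and the `√2` cancels the one in
    -- `√(2n)`.
    refine ⟨Real.exp 1, Real.exp_pos 1, fun n hn => ?_⟩
    obtain ⟨m, rfl⟩ : ∃ m, n = m + 1 := ⟨n - 1, by omega⟩
    have h : Stirling.stirlingSeq (m + 1) ≤ Stirling.stirlingSeq 1 := by
      exact Stirling.stirlingSeq'_antitone (Nat.zero_le m)
    rw [Stirling.stirlingSeq_one, Stirling.stirlingSeq] at h
    have hm : (0 : ℝ) < ((m + 1 : ℕ) : ℝ) := by positivity
    rw [div_le_div_iff₀ (by positivity) (by positivity)] at h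
    have hs : √(2 * ((m + 1 : ℕ) : ℝ)) = √2 * √((m + 1 : ℕ) : ℝ) := Real.sqrt_mul (by norm_num) _
    rw [hs] at h
    have h2 : (0 : ℝ) < √2 := by positivity
    have h3 : ((m + 1).factorial : ℝ) ≤ Real.exp 1 *
        (√((m + 1 : ℕ) : ℝ) * (((m + 1 : ℕ) : ℝ) / Real.exp 1) ^ (m + 1)) := by
      refine le_of_mul_le_mul_right (h.trans (le_of_eq ?_)) h2
      ring
    refine h3.trans (le_of_eq ?_)
    rw [Real.rpow_add hm, Real.rpow_natCast, ← Real.sqrt_eq_rpow, div_pow, ← Real.exp_nat_mul,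
      mul_one, Real.exp_neg]
    field_simp
  refine ⟨C * Real.exp 1, by positivity, fun x hx => ?_⟩
  set n := ⌊x⌋₊ with hn
  have hn1 : 1 ≤ n := Nat.le_floor (by simpa using hx)
  have hnx : (n : ℝ) ≤ x := Nat.floor_le (by linarith)
  have hxn : x < n + 1 := Nat.lt_floor_add_one x
  have hn0 : (0 : ℝ) < n := by exact_mod_cast hn1
  have hxn0 : 0 ≤ x - n := by linarith
  -- Log-convexity of `Γ` between `n = ⌊x⌋₊` and `n + 1`. Replacing `e^{-n}` by `e^{1-x}` later
  -- costs the extra factor `e` in the constant.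
  have hG : Gamma x ≤ Gamma n * (n : ℝ) ^ (x - n) := by
    rcases hxn0.eq_or_lt with h0 | h0
    · rw [← h0, Real.rpow_zero, mul_one, sub_eq_zero.1 h0.symm]
    · have h := Real.Gamma_mul_add_mul_le_rpow_Gamma_mul_rpow_Gamma (s := n) (t := n + 1)
        (a := 1 - (x - n)) (b := x - n) hn0 (by linarith) (by linarith) h0 (by ring)
      rw [show (1 - (x - n)) * (n : ℝ) + (x - n) * ((n : ℝ) + 1) = x by ring] at h
      refine h.trans (le_of_eq ?_)
      have hg := Real.Gamma_pos_of_pos hn0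
      rw [Real.Gamma_add_one hn0.ne', Real.mul_rpow hn0.le hg.le, mul_left_comm,
        ← Real.rpow_add hg, sub_add_cancel, Real.rpow_one, mul_comm]
  have hGn : Gamma n * n = n.factorial := by
    rw [← Real.Gamma_nat_eq_factorial, Real.Gamma_add_one hn0.ne', mul_comm]
  calc Gamma x ≤ Gamma n * (n : ℝ) ^ (x - n) := hG
    _ = n.factorial * (n : ℝ) ^ (x - n - 1) := by
      rw [← hGn, Real.rpow_sub_one hn0.ne']; field_simp
    _ ≤ C * ((n : ℝ) ^ ((n : ℝ) + 1 / 2) * Real.exp (-n)) * (n : ℝ) ^ (x - n - 1) := by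
      gcongr; exact hfac n hn1
    _ = C * ((n : ℝ) ^ (x - 1 / 2) * Real.exp (-n)) := by
      rw [show x - 1 / 2 = ((n : ℝ) + 1 / 2) + (x - n - 1) by ring, Real.rpow_add hn0 ((n : ℝ) + 1 / 2)]
      ac_rfl
    _ ≤ C * (x ^ (x - 1 / 2) * Real.exp (1 - x)) := by
      gcongr
      · linarith
      · linarith
    _ = _ := by rw [sub_eq_add_neg 1 x, Real.exp_add]; ring

/-- From `1 + t ≤ e^t` at `t = a/c`: a bounded shift `a` of the base costs a factor that stays
bounded when `x` and `c` grow proportionally. -/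
theorem rpow_self_le {x c a : ℝ} (hx : 0 ≤ x) (hc : 0 < c) (h : x = c + a) :
    x ^ x ≤ c ^ x * Real.exp (a / c * x) := by
  have h1 : x = c * (1 + a / c) := by rw [h]; field_simp
  have h2 : 0 ≤ 1 + a / c := by
    by_contra! hn
    nlinarith
  calc x ^ x = (c * (1 + a / c)) ^ x := by rw [← h1]
    _ = c ^ x * (1 + a / c) ^ x := Real.mul_rpow hc.le h2
    _ ≤ c ^ x * Real.exp (a / c) ^ x := by
      gcongr
      linarith [Real.add_one_le_exp (a / c)]
    _ = _ := by rw [← Real.exp_mul]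

theorem rpow_sub_half_le {x c d a : ℝ} (hd : 0 < d) (hdx : d ≤ x) (hc : 0 < c) (h : x = c + a) :
    x ^ (x - 1 / 2) ≤ c ^ x * Real.exp (a / c * x) / √d := by
  have hx : 0 < x := hd.trans_le hdx
  rw [Real.rpow_sub hx, ← Real.sqrt_eq_rpow]
  have := rpow_self_le hx.le hc h
  gcongr

/-- Stirling's lower bound for `(k+1)!`, squared, with one factor `k + 1` cancelled. -/
theorem le_gamma_sq (k : ℕ) :
    2 * Real.pi * (((k : ℝ) + 1) / Real.exp 1) ^ (2 * k + 2) ≤ Gamma (k + 1) ^ 2 * (k + 1) := by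
  have h := Stirling.le_factorial_stirling (k + 1)
  have h2 := pow_le_pow_left₀ (by positivity) h 2
  rw [mul_pow, Real.sq_sqrt (by positivity), ← pow_mul, Nat.factorial_succ,
    show (k + 1) * 2 = 2 * k + 2 by ring] at h2
  rw [Real.Gamma_nat_eq_factorial]
  push_cast at h2
  have hk : (0 : ℝ) < (k : ℝ) + 1 := by positivity
  refine le_of_mul_le_mul_right ?_ hk
  calc _ = 2 * Real.pi * ((k : ℝ) + 1) * (((k : ℝ) + 1) / Real.exp 1) ^ (2 * k + 2) := by ring
    _ ≤ _ := h2
    _ = _ := by ring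

/-- Put `m = k + 1`. The arguments of the two Gamma factors are `x = 2m/γ + a` and `y = 2m(γ-1)/γ -
a`, with sum `2m`. By Stirling the numerator is at most a constant times `(m/e)^(2m) / m`, since the
powers of `γ/2` and `γ-1` cancel exactly, and `Γ(m)²` is at least a constant times the same
quantity. -/
theorem exists_symbol_le {γ r : ℝ} (hγ : 1 < γ) : ∃ C, ∀ k, symbol γ r k ≤ C := by
  obtain ⟨C, hC, hG⟩ := exists_gamma_le
  have hγ0 : 0 < γ := by linarith
  have hγ1 : 0 < γ - 1 := by linarith
  set a := (r - 1) / γ with ha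
  have hx : ∀ k : ℕ, (2 * k + 1 + r) / γ = 2 * ((k : ℝ) + 1) / γ + a := by
    intro k; rw [ha]; field_simp; ring
  have hy : ∀ k : ℕ, 2 * k + 2 - (2 * k + 1 + r) / γ
      = 2 * ((k : ℝ) + 1) * (γ - 1) / γ + -a := by
    intro k; rw [ha]; field_simp; ring
  have hlim : ∀ c b : ℝ, 0 < c → ∀ᶠ k : ℕ in atTop, b ≤ ((k : ℝ) + 1) * c := fun c b hc =>
    ((tendsto_atTop_add_const_right atTop 1 tendsto_natCast_atTop_atTop).atTop_mul_const
      hc).eventually_ge_atTop b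
  set B := C ^ 2 * Real.exp (a ^ 2 * γ ^ 2 / (2 * (γ - 1))) * γ / (2 * Real.pi * √(γ - 1))
  have hB : ∀ᶠ k : ℕ in atTop, symbol γ r k ≤ B := by
    -- For large `k` both arguments are at least `1`, where the Stirling bound applies, and at least
    -- half of their main terms, which controls the square roots.
    filter_upwards [hlim (2 / γ) (1 - a) (by positivity),
      hlim (2 * (γ - 1) / γ) (1 + a) (by positivity), hlim (1 / γ) (-a) (by positivity),
      hlim ((γ - 1) / γ) a (by positivity)] with k h1 h2 h3 h4
    rw [symbol]
    set x := (2 * k + 1 + r) / γ with hxd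
    set y := 2 * k + 2 - x with hyd
    set m := (k : ℝ) + 1 with hm
    have hm1 : 1 ≤ m := by simp [hm]
    have hm0 : 0 < m := by linarith
    have hxk : x = 2 * m / γ + a := hx k
    have hyk : y = 2 * m * (γ - 1) / γ + -a := hy k
    have hx1 : 1 ≤ x := by rw [hxk]; have : m * (2 / γ) = 2 * m / γ := by ring
                           linarith
    have hy1 : 1 ≤ y := by
      rw [hyk]
      have : m * (2 * (γ - 1) / γ) = 2 * m * (γ - 1) / γ := by ring
      linarith
    have hxd : m / γ ≤ x := by
      rw [hxk]
      have e1 : m * (1 / γ) = m / γ := by ring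
      have e2 : 2 * m / γ = m / γ + m / γ := by ring
      linarith
    have hyd' : m * (γ - 1) / γ ≤ y := by
      rw [hyk]
      have e1 : m * ((γ - 1) / γ) = m * (γ - 1) / γ := by ring
      have e2 : 2 * m * (γ - 1) / γ = m * (γ - 1) / γ + m * (γ - 1) / γ := by ring
      linarith
    have hGx := (hG x hx1).trans (mul_le_mul_of_nonneg_left (mul_le_mul_of_nonneg_right
      (rpow_sub_half_le (by positivity) hxd (by positivity) hxk) (Real.exp_pos _).le) hC.le)
    have hGy := (hG y hy1).trans (mul_le_mul_of_nonneg_left (mul_le_mul_of_nonneg_right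
      (rpow_sub_half_le (by positivity) hyd' (by positivity) hyk) (Real.exp_pos _).le) hC.le)
    have hxy : x + y = ((2 * k + 2 : ℕ) : ℝ) := by push_cast; simp [hyd]
    set P := (m / Real.exp 1) ^ (2 * k + 2) with hP
    have hP0 : 0 < P := by positivity
    have hk := le_gamma_sq k
    have hGxpos : 0 < Gamma x := Real.Gamma_pos_of_pos (by linarith)
    have hGypos : 0 < Gamma y := Real.Gamma_pos_of_pos (by linarith)
    have hprod : Gamma x * Gamma y * (γ / 2) ^ (2 * k + 2) * (γ - 1) ^ (-y)
        ≤ C ^ 2 * Real.exp (a ^ 2 * γ ^ 2 / (2 * (γ - 1))) * γ / (m * √(γ - 1)) * P := by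
      -- The contributions linear in `a` are `a` and `-a` and cancel; the quadratic remainder is
      -- `O(1/m)`.
      have hE : a / (2 * m / γ) * x + -a / (2 * m * (γ - 1) / γ) * y
          ≤ a ^ 2 * γ ^ 2 / (2 * (γ - 1)) := by
        have : a / (2 * m / γ) * x + -a / (2 * m * (γ - 1) / γ) * y
            = a ^ 2 * γ ^ 2 / (2 * (γ - 1)) / m := by
          rw [hxk, hyk]; field_simp; ring
        rw [this]
        exact div_le_self (by positivity) hm1
      have hsq : √(m / γ) * √(m * (γ - 1) / γ) = m / γ * √(γ - 1) := by
        rw [← Real.sqrt_mul (by positivity), show m / γ * (m * (γ - 1) / γ)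
          = (m / γ) ^ 2 * (γ - 1) by ring, Real.sqrt_mul (by positivity),
          Real.sqrt_sq (by positivity)]
      have hpow : (2 * m / γ) ^ x * (2 * m * (γ - 1) / γ) ^ y * (Real.exp (-x) * Real.exp (-y))
          * (γ / 2) ^ (2 * k + 2) * (γ - 1) ^ (-y) = P := by
        rw [show 2 * m * (γ - 1) / γ = 2 * m / γ * (γ - 1) by ring,
          Real.mul_rpow (by positivity) hγ1.le, Real.rpow_neg hγ1.le]
        have e1 : (2 * m / γ) ^ x * (2 * m / γ) ^ y = (2 * m / γ) ^ (2 * k + 2) := by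
          rw [← Real.rpow_add (by positivity), hxy, Real.rpow_natCast]
        have e2 : Real.exp (-x) * Real.exp (-y) = (Real.exp 1)⁻¹ ^ (2 * k + 2) := by
          rw [← Real.exp_add, ← Real.exp_neg, ← Real.exp_nat_mul, ← hxy]; congr 1; ring
        have e3 : (γ - 1) ^ y ≠ 0 := (Real.rpow_pos_of_pos hγ1 _).ne'
        calc _ = ((2 * m / γ) ^ x * (2 * m / γ) ^ y) * (Real.exp (-x) * Real.exp (-y))
              * (γ / 2) ^ (2 * k + 2) * ((γ - 1) ^ y * ((γ - 1) ^ y)⁻¹) := by ring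
          _ = P := by
            rw [e1, e2, mul_inv_cancel₀ e3, mul_one, ← mul_pow, ← mul_pow, hP]
            congr 1
            field_simp
      calc _ ≤ (C * ((2 * m / γ) ^ x * Real.exp (a / (2 * m / γ) * x) / √(m / γ) * Real.exp (-x)))
            * (C * ((2 * m * (γ - 1) / γ) ^ y * Real.exp (-a / (2 * m * (γ - 1) / γ) * y)
              / √(m * (γ - 1) / γ) * Real.exp (-y))) * (γ / 2) ^ (2 * k + 2) * (γ - 1) ^ (-y) := by
            gcongr
        _ = C ^ 2 * Real.exp (a / (2 * m / γ) * x + -a / (2 * m * (γ - 1) / γ) * y)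
            / (√(m / γ) * √(m * (γ - 1) / γ)) * ((2 * m / γ) ^ x * (2 * m * (γ - 1) / γ) ^ y *
            (Real.exp (-x) * Real.exp (-y)) * (γ / 2) ^ (2 * k + 2) * (γ - 1) ^ (-y)) := by
            rw [Real.exp_add]; ring
        _ = C ^ 2 * Real.exp (a / (2 * m / γ) * x + -a / (2 * m * (γ - 1) / γ) * y)
            / (m / γ * √(γ - 1)) * P := by rw [hpow, hsq]
        _ ≤ C ^ 2 * Real.exp (a ^ 2 * γ ^ 2 / (2 * (γ - 1))) / (m / γ * √(γ - 1)) * P := by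
            gcongr
        _ = _ := by congr 1; field_simp
    have hΓ : 0 < Gamma (k + 1) ^ 2 := by
      have := Real.Gamma_pos_of_pos hm0
      positivity
    calc _ = Gamma x * Gamma y * (γ / 2) ^ (2 * k + 2) * (γ - 1) ^ (-y) / Gamma (k + 1) ^ 2 := by
          ring
      _ ≤ B := by
        rw [div_le_iff₀ hΓ]
        refine hprod.trans ?_
        have hπ := Real.pi_pos
        have hs : 0 < √(γ - 1) := Real.sqrt_pos.2 hγ1
        calc _ = B / m * (2 * Real.pi * P) := by simp only [B]; field_simp
          _ ≤ B / m * (Gamma (k + 1) ^ 2 * m) := by gcongr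
          _ = _ := by field_simp
  obtain ⟨C', hC'⟩ := (Filter.isBoundedUnder_of_eventually_le (f := atTop) hB).bddAbove_range
  exact ⟨C', fun k => hC' ⟨k, rfl⟩⟩

end

/-! ### Normalized profiles -/

section

open scoped InnerProductSpace

theorem memLp_two_of_lintegral {X : Type*} [MeasurableSpace X] {μ : Measure X} {f : X → ℂ}
    (hf : AEStronglyMeasurable f μ) (h : ∫⁻ x, ‖f x‖ₑ ^ 2 ∂μ ≠ ⊤) : MemLp f 2 μ := by
  refine ⟨hf, ?_⟩
  rw [eLpNorm_lt_top_iff_lintegral_rpow_enorm_lt_top (by norm_num) (by norm_num)]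
  simpa using h.lt_top

theorem lintegral_ne_top_of_memLp_two {X : Type*} [MeasurableSpace X] {μ : Measure X} {f : X → ℂ}
    (hf : MemLp f 2 μ) : ∫⁻ x, ‖f x‖ₑ ^ 2 ∂μ ≠ ⊤ := by
  have := hf.2
  rw [eLpNorm_lt_top_iff_lintegral_rpow_enorm_lt_top (by norm_num) (by norm_num)] at this
  simpa using this.ne

/-- Lebesgue measure on the positive half-line. -/
abbrev halfLine : Measure ℝ := volume.restrict (Set.Ioi 0)

/-- The radial measure `α ^ r dα` on the positive half-line. -/
abbrev radial (r : ℝ) : Measure ℝ := halfLine.withDensity fun α => ENNReal.ofReal (α ^ r)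

/-- The measure `dθ ds`. -/
abbrev angular : Measure (ℝ × ℝ) :=
  (volume.restrict (Set.Ico (0 : ℝ) (2 * Real.pi))).prod volume

theorem measurable_ofReal_rpow (r : ℝ) : Measurable fun α : ℝ => ENNReal.ofReal (α ^ r) := by
  fun_prop

theorem ae_radial_pos (r : ℝ) : ∀ᵐ α ∂(radial r), 0 < α :=
  (withDensity_absolutelyContinuous _ _).ae_le (ae_restrict_mem measurableSet_Ioi)

theorem ae_mu_pos (γ r : ℝ) : ∀ᵐ ζ ∂(mu γ r), 0 < ‖ζ.1.1‖ := by
  have hm : MeasurableSet {ζ : surface γ | 0 < ‖ζ.1.1‖} :=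
    measurableSet_lt measurable_const (by fun_prop)
  rw [mu, ae_map_iff (measurable_param γ).aemeasurable hm]
  refine (Measure.quasiMeasurePreserving_fst.ae (ae_radial_pos r)).mono fun p hp => ?_
  simpa [param, Complex.norm_exp] using hp.ne'

theorem lintegral_mu (γ r : ℝ) {F : surface γ → ENNReal} (hF : Measurable F) :
    ∫⁻ ζ, F ζ ∂(mu γ r) = ∫⁻ α, ∫⁻ z, F (param γ (α, z)) ∂angular ∂(radial r) := by
  rw [mu, lintegral_map hF (measurable_param γ)]
  exact lintegral_prod _ (hF.comp (measurable_param γ)).aemeasurable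

theorem integral_mu (γ r : ℝ) {F : surface γ → ℂ} (hF : Integrable F (mu γ r)) :
    ∫ ζ, F ζ ∂(mu γ r) = ∫ α, ∫ z, F (param γ (α, z)) ∂angular ∂(radial r) := by
  rw [mu, integral_map (measurable_param γ).aemeasurable hF.1]
  exact integral_prod _ ((integrable_map_measure hF.1 (measurable_param γ).aemeasurable).1 hF)

theorem integral_radial (r : ℝ) (F : ℝ → ℂ) :
    ∫ α, F α ∂(radial r) = ∫ α in Set.Ioi 0, (α ^ r : ℝ) * F α := by
  rw [integral_withDensity_eq_integral_toReal_smul (measurable_ofReal_rpow r)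
    (ae_of_all _ fun _ => ENNReal.ofReal_lt_top)]
  refine setIntegral_congr_fun measurableSet_Ioi fun α hα => ?_
  have : 0 ≤ α ^ r := Real.rpow_nonneg (le_of_lt hα) r
  simp [ENNReal.toReal_ofReal this]

/-- The exponent `(2p + 1 + r) / γ`. -/
def expo (γ r p : ℝ) : ℝ := (2 * p + 1 + r) / γ

/-- Profiles `N α ^ p ξ ^ (q / 2) e ^ (-b ξ α ^ γ)`, normalized in `L²(α ^ r dα)` for every `ξ`. -/
def profile (γ r p b α ξ : ℝ) : ℝ :=
  √(γ * (2 * b) ^ expo γ r p / Real.Gamma (expo γ r p)) * α ^ p * ξ ^ (expo γ r p / 2)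
    * Real.exp (-(b * ξ * α ^ γ))

theorem measurable_profile (γ r p b : ℝ) :
    Measurable fun z : ℝ × ℝ => profile γ r p b z.1 z.2 := by
  unfold profile
  fun_prop

/-- The pairing of two normalized profiles. -/
def pairing (γ r p b p' b' : ℝ) : ℝ :=
  √(γ * (2 * b) ^ expo γ r p / Real.Gamma (expo γ r p))
    * √(γ * (2 * b') ^ expo γ r p' / Real.Gamma (expo γ r p'))
    * (Real.Gamma ((expo γ r p + expo γ r p') / 2)
      / (γ * (b + b') ^ ((expo γ r p + expo γ r p') / 2)))

section Profile

variable {γ r p b p' b' : ℝ}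

theorem expo_pos (hγ : 1 < γ) (hp : 0 < 2 * p + 1 + r) : 0 < expo γ r p :=
  div_pos hp (by linarith)

theorem pairing_self (hγ : 1 < γ) (hp : 0 < 2 * p + 1 + r) (hb : 0 < b) :
    pairing γ r p b p b = 1 := by
  have hq := expo_pos hγ hp
  have hΓ := Real.Gamma_pos_of_pos hq
  have hγ0 : 0 < γ := by linarith
  rw [pairing, add_self_div_two, Real.mul_self_sqrt (by positivity), ← two_mul b]
  field_simp

theorem profile_mul_profile {α ξ : ℝ} (hα : 0 < α) (hξ : 0 < ξ) :
    α ^ r * (profile γ r p b α ξ * profile γ r p' b' α ξ)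
      = (√(γ * (2 * b) ^ expo γ r p / Real.Gamma (expo γ r p))
        * √(γ * (2 * b') ^ expo γ r p' / Real.Gamma (expo γ r p'))
        * ξ ^ ((expo γ r p + expo γ r p') / 2)) *
        (α ^ (p + p' + r) * Real.exp (-((b + b') * ξ) * α ^ γ)) := by
  rw [profile, profile, Real.rpow_add hα, Real.rpow_add hα, add_div, Real.rpow_add hξ,
    show -((b + b') * ξ) * α ^ γ = -(b * ξ * α ^ γ) + -(b' * ξ * α ^ γ) by ring, Real.exp_add]
  ring

/-- The factors `ξ^(q/2)` cancel exactly the power of `ξ` produced by the Gamma integral. Because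
the value does not depend on `ξ`, pairings of superpositions are scalar multiples of the inner
product in the frequency variable. -/
theorem integral_profile_mul_profile (hγ : 1 < γ) (hp : 0 < 2 * p + 1 + r)
    (hp' : 0 < 2 * p' + 1 + r) (hb : 0 < b) (hb' : 0 < b') {ξ : ℝ} (hξ : 0 < ξ) :
    ∫ α in Set.Ioi 0, α ^ r * (profile γ r p b α ξ * profile γ r p' b' α ξ)
      = pairing γ r p b p' b' := by
  have hγ0 : 0 < γ := by linarith
  rw [setIntegral_congr_fun measurableSet_Ioi
    (fun α hα => profile_mul_profile (p := p) (p' := p') (b := b) (b' := b') hα hξ),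
    integral_const_mul, integral_rpow_mul_exp_neg_mul_rpow hγ0 (by linarith) (by positivity)]
  have e : (p + p' + r + 1) / γ = (expo γ r p + expo γ r p') / 2 := by
    rw [expo, expo]; field_simp; ring
  rw [neg_div, e, Real.rpow_neg (by positivity), Real.mul_rpow (by positivity) hξ.le, pairing]
  have : ξ ^ ((expo γ r p + expo γ r p') / 2) ≠ 0 := (Real.rpow_pos_of_pos hξ _).ne'
  field_simp

theorem lintegral_profile_sq (hγ : 1 < γ) (hp : 0 < 2 * p + 1 + r) (hb : 0 < b) {ξ : ℝ}
    (hξ : 0 < ξ) : ∫⁻ α, ‖(profile γ r p b α ξ : ℂ)‖ₑ ^ 2 ∂(radial r) = 1 := by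
  have hγ0 : 0 < γ := by linarith
  have hm : Measurable fun α => ‖(profile γ r p b α ξ : ℂ)‖ₑ ^ 2 := by
    unfold profile; fun_prop
  rw [lintegral_withDensity_eq_lintegral_mul _ (measurable_ofReal_rpow r) hm]
  have e : ∫⁻ α in Set.Ioi 0, ((fun α => ENNReal.ofReal (α ^ r)) * fun α =>
      ‖(profile γ r p b α ξ : ℂ)‖ₑ ^ 2) α = ∫⁻ α in Set.Ioi 0,
        ENNReal.ofReal (α ^ r * (profile γ r p b α ξ * profile γ r p b α ξ)) := by
    refine setLIntegral_congr_fun measurableSet_Ioi fun α hα => ?_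
    have : 0 ≤ α ^ r := Real.rpow_nonneg (le_of_lt hα) r
    simp only [Pi.mul_apply]
    rw [ENNReal.ofReal_mul this, ← sq, ← ofReal_norm, Complex.norm_real,
      ← ENNReal.ofReal_pow (norm_nonneg _), Real.norm_eq_abs, sq_abs]
  rw [e, ← ofReal_integral_eq_lintegral_ofReal, integral_profile_mul_profile hγ hp hp hb hb hξ,
    pairing_self hγ hp hb, ENNReal.ofReal_one]
  · refine Integrable.congr ?_ ((ae_restrict_mem measurableSet_Ioi).mono fun α hα =>
      (profile_mul_profile (p := p) (p' := p) (b := b) (b' := b) hα hξ).symm)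
    refine Integrable.const_mul ?_ _
    exact integrableOn_rpow_mul_exp_neg_mul_rpow (by linarith) hγ0 (by positivity)
  · refine (ae_restrict_mem measurableSet_Ioi).mono fun α hα => ?_
    exact mul_nonneg (Real.rpow_nonneg (le_of_lt hα) r) (mul_self_nonneg _)

theorem profile_nonneg {α ξ : ℝ} (hα : 0 ≤ α) (hξ : 0 ≤ ξ) : 0 ≤ profile γ r p b α ξ := by
  unfold profile; positivity

/-- Apply `u ≤ e^u` at `u = ct/s` and raise to the power `s`. -/
theorem rpow_mul_exp_le {s c t : ℝ} (hs : 0 < s) (hc : 0 < c) (ht : 0 ≤ t) :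
    t ^ s * Real.exp (-(c * t)) ≤ (s / c) ^ s := by
  have h1 : t = s / c * (c * t / s) := by field_simp
  have h2 : c * t / s ≤ Real.exp (c * t / s) := by linarith [Real.add_one_le_exp (c * t / s)]
  have h3 : t ^ s ≤ (s / c) ^ s * Real.exp (c * t) := by
    calc t ^ s = (s / c) ^ s * (c * t / s) ^ s := by
          rw [← Real.mul_rpow (by positivity) (by positivity), ← h1]
      _ ≤ (s / c) ^ s * Real.exp (c * t / s) ^ s := by gcongr
      _ = _ := by rw [← Real.exp_mul, div_mul_cancel₀ _ hs.ne']
  rw [Real.exp_neg]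
  exact mul_inv_le_of_le_mul₀ (Real.exp_pos _).le (by positivity) h3

theorem exists_profile_le (hγ : 1 < γ) (hp : 0 < 2 * p + 1 + r) (hb : 0 < b) {α : ℝ}
    (hα : 0 < α) : ∃ C, ∀ ξ, 0 < ξ → ‖(profile γ r p b α ξ : ℂ)‖ ≤ C := by
  have hq := expo_pos hγ hp
  have hγ0 : 0 < γ := by linarith
  refine ⟨√(γ * (2 * b) ^ expo γ r p / Real.Gamma (expo γ r p)) * α ^ p *
    (expo γ r p / 2 / (b * α ^ γ)) ^ (expo γ r p / 2), fun ξ hξ => ?_⟩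
  rw [Complex.norm_real, Real.norm_of_nonneg (profile_nonneg hα.le hξ.le), profile]
  have h := rpow_mul_exp_le (s := expo γ r p / 2) (c := b * α ^ γ) (by positivity)
    (by positivity) hξ.le
  rw [show b * ξ * α ^ γ = b * α ^ γ * ξ by ring, mul_assoc _ (ξ ^ _)]
  gcongr

theorem memLp_profile (hγ : 1 < γ) (hp : 0 < 2 * p + 1 + r) (hb : 0 < b) {α : ℝ}
    (hα : 0 < α) : MemLp (fun ξ => (profile γ r p b α ξ : ℂ)) 2 halfLine := by
  have hq := expo_pos hγ hp
  rw [memLp_two_iff_integrable_sq_norm (by unfold profile; fun_prop)]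
  have hi := (integrableOn_rpow_mul_exp_neg_mul_rpow (s := expo γ r p) (p := 1)
    (b := 2 * b * α ^ γ) (by linarith) one_pos (by positivity)).const_mul
      ((√(γ * (2 * b) ^ expo γ r p / Real.Gamma (expo γ r p)) * α ^ p) ^ 2)
  refine hi.congr ((ae_restrict_mem measurableSet_Ioi).mono fun ξ hξ => ?_)
  have hξ' : 0 < ξ := hξ
  simp only [Complex.norm_real, Real.norm_of_nonneg (profile_nonneg hα.le hξ'.le)]
  have e1 : (ξ ^ (expo γ r p / 2)) ^ 2 = ξ ^ expo γ r p := by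
    rw [← Real.rpow_natCast, ← Real.rpow_mul hξ'.le]
    congr 1; push_cast; ring
  have e2 : Real.exp (-(b * ξ * α ^ γ)) ^ 2 = Real.exp (-(2 * b * α ^ γ) * ξ ^ (1 : ℝ)) := by
    rw [← Real.exp_nat_mul, Real.rpow_one]
    congr 1; push_cast; ring
  rw [profile, ← e1, ← e2]
  ring

theorem memLp_profile_mul (hγ : 1 < γ) (hp : 0 < 2 * p + 1 + r) (hb : 0 < b) {α : ℝ}
    (hα : 0 < α) {g : ℝ → ℂ} (hg : MemLp g 2 halfLine) :
    MemLp (fun ξ => (profile γ r p b α ξ : ℂ) * g ξ) 2 halfLine := by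
  obtain ⟨C, hC⟩ := exists_profile_le (p := p) hγ hp hb hα
  refine MemLp.of_le_mul (c := C) hg ?_ ((ae_restrict_mem measurableSet_Ioi).mono fun ξ hξ => ?_)
  · exact AEStronglyMeasurable.mul (by unfold profile; fun_prop) hg.1
  · rw [norm_mul]
    exact mul_le_mul_of_nonneg_right (hC ξ hξ) (norm_nonneg _)

/-- Together with `memLp_profile_mul` this puts each radial slice in `L¹ ∩ L²`, where the Fourier
integral and Plancherel are both available. -/
theorem integrable_profile_mul (hγ : 1 < γ) (hp : 0 < 2 * p + 1 + r) (hb : 0 < b) {α : ℝ}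
    (hα : 0 < α) {g : ℝ → ℂ} (hg : MemLp g 2 halfLine) :
    Integrable (fun ξ => (profile γ r p b α ξ : ℂ) * g ξ) halfLine :=
  MemLp.integrable_mul (memLp_profile hγ hp hb hα) hg

end Profile

end

/-! ### Superpositions of profiles -/

section

open scoped InnerProductSpace

variable {γ r p b p' b' : ℝ}

/-- The superposition `e^{ikθ} (2π)⁻¹ ∫_0^∞ profile(α, ξ) g(ξ) e^{iξs} dξ` as a function on `M_γ`. -/
def synth (γ r p b : ℝ) (k : ℤ) (g : ℝ → ℂ) (ζ : surface γ) : ℂ :=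
  (ζ.1.1 / ‖ζ.1.1‖) ^ k * ((2 * Real.pi : ℝ) : ℂ)⁻¹ *
    ∫ ξ in Set.Ioi 0, (profile γ r p b ‖ζ.1.1‖ ξ : ℂ) * g ξ * Complex.exp (Complex.I * ξ * ζ.1.2.re)

theorem synth_congr {k : ℤ} {g h : ℝ → ℂ} (hgh : g =ᵐ[halfLine] h) :
    synth γ r p b k g = synth γ r p b k h := by
  ext ζ
  rw [synth, synth]
  congr 1
  apply integral_congr_ae
  filter_upwards [hgh] with ξ hξ
  rw [hξ]

theorem measurable_synth_of_measurable {k : ℤ} {g : ℝ → ℂ} (hg : Measurable g) :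
    Measurable (synth γ r p b k g) := by
  have h1 : Measurable fun z : surface γ × ℝ => (profile γ r p b ‖z.1.1.1‖ z.2 : ℂ) * g z.2 *
      Complex.exp (Complex.I * z.2 * z.1.1.2.re) := by
    unfold profile
    fun_prop
  have h2 : Measurable fun ζ : surface γ => ∫ ξ in Set.Ioi 0, (profile γ r p b ‖ζ.1.1‖ ξ : ℂ) * g ξ
      * Complex.exp (Complex.I * ξ * ζ.1.2.re) :=
    (h1.stronglyMeasurable.integral_prod_right' (ν := halfLine)).measurable
  have h3 : Measurable fun ζ : surface γ => (ζ.1.1 / ‖ζ.1.1‖ : ℂ) ^ k := by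
    have : Measurable fun z : ℂ => z ^ k := by
      cases k with
      | ofNat n => simpa using (measurable_id (α := ℂ)).pow_const n
      | negSucc n => simpa [zpow_negSucc] using (measurable_id (α := ℂ)).pow_const (n + 1)
    exact this.comp (by fun_prop)
  exact (h3.mul_const _).mul h2

theorem measurable_synth {k : ℤ} {g : ℝ → ℂ} (hg : MemLp g 2 halfLine) :
    Measurable (synth γ r p b k g) := by
  rw [synth_congr hg.coeFn_toLp.symm]
  exact measurable_synth_of_measurable (Lp.stronglyMeasurable _).measurable

/-- The function `profile * g`, extended by zero to the line. -/
def slice (γ r p b : ℝ) (g : ℝ → ℂ) (α : ℝ) : ℝ → ℂ :=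
  (Set.Ioi 0).indicator fun ξ => (profile γ r p b α ξ : ℂ) * g ξ

theorem memLp_slice (hγ : 1 < γ) (hp : 0 < 2 * p + 1 + r) (hb : 0 < b) {α : ℝ}
    (hα : 0 < α) {g : ℝ → ℂ} (hg : MemLp g 2 halfLine) : MemLp (slice γ r p b g α) 2 :=
  (memLp_indicator_iff_restrict measurableSet_Ioi).2 (memLp_profile_mul hγ hp hb hα hg)

theorem integrable_slice (hγ : 1 < γ) (hp : 0 < 2 * p + 1 + r) (hb : 0 < b) {α : ℝ}
    (hα : 0 < α) {g : ℝ → ℂ} (hg : MemLp g 2 halfLine) : Integrable (slice γ r p b g α) :=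
  (integrable_indicator_iff measurableSet_Ioi).2 (integrable_profile_mul hγ hp hb hα hg)

theorem integral_halfLine_eq_fint (u : ℝ → ℂ) (s : ℝ) :
    ∫ ξ in Set.Ioi 0, u ξ * Complex.exp (Complex.I * ξ * s) = fint ((Set.Ioi 0).indicator u) s := by
  rw [fint, ← integral_indicator measurableSet_Ioi]
  congr 1
  ext ξ
  by_cases hξ : ξ ∈ Set.Ioi (0 : ℝ) <;> simp [hξ]

theorem synth_param {k : ℤ} {g : ℝ → ℂ} {α : ℝ} (hα : 0 < α) (z : ℝ × ℝ) :
    synth γ r p b k g (param γ (α, z)) =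
      (Complex.exp (Complex.I * z.1) ^ k * ((2 * Real.pi : ℝ) : ℂ)⁻¹)
        * fint (slice γ r p b g α) z.2 := by
  have h1 : ‖(param γ (α, z)).1.1‖ = α := by
    simp [param, Complex.norm_exp, hα.le]
  have h2 : (param γ (α, z)).1.2.re = z.2 := by simp [param]
  have h3 : (param γ (α, z)).1.1 = α * Complex.exp (Complex.I * z.1) := rfl
  have hα' : (α : ℂ) ≠ 0 := by exact_mod_cast hα.ne'
  rw [synth, h1, h2, h3, mul_div_cancel_left₀ _ hα', slice, ← integral_halfLine_eq_fint]

theorem integral_exp_angle (n : ℤ) :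
    ∫ θ in Set.Ico 0 (2 * Real.pi), Complex.exp (Complex.I * θ) ^ n
      = if n = 0 then ((2 * Real.pi : ℝ) : ℂ) else 0 := by
  rw [integral_Ico_eq_integral_Ioc, ← intervalIntegral.integral_of_le (by positivity)]
  split_ifs with h
  · simp [h]
  · have hn : (n * Complex.I : ℂ) ≠ 0 := by simp [h]
    have e : ∀ θ : ℝ, Complex.exp (Complex.I * θ) ^ n = Complex.exp (n * Complex.I * θ) := by
      intro θ; rw [← Complex.exp_int_mul]; ring_nf
    simp_rw [e]
    rw [integral_exp_mul_complex hn]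
    have : (n * Complex.I * ((2 * Real.pi : ℝ) : ℂ)) = n * (2 * Real.pi * Complex.I) := by
      push_cast; ring
    rw [this, Complex.exp_int_mul_two_pi_mul_I]
    simp

/-- Plancherel in `s` at fixed `α`, then Tonelli and the normalization of the profile in `α` at
fixed `ξ`. The two factors `2π` from `θ` and Plancherel cancel the prefactor `(2π)⁻²`. -/
theorem lintegral_enorm_synth_sq (hγ : 1 < γ) (hp : 0 < 2 * p + 1 + r) (hb : 0 < b) {k : ℤ}
    {g : ℝ → ℂ} (hg : Measurable g) (hg2 : MemLp g 2 halfLine) :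
    ∫⁻ ζ, ‖synth γ r p b k g ζ‖ₑ ^ 2 ∂(mu γ r) = ∫⁻ ξ, ‖g ξ‖ₑ ^ 2 ∂halfLine := by
  have hπ : ENNReal.ofReal (2 * Real.pi) ≠ 0 := by
    simpa using Real.pi_pos
  have hang : ∀ α, 0 < α → ∫⁻ z, ‖synth γ r p b k g (param γ (α, z))‖ₑ ^ 2 ∂angular
      = ∫⁻ ξ, ‖(profile γ r p b α ξ : ℂ)‖ₑ ^ 2 * ‖g ξ‖ₑ ^ 2 ∂halfLine := by
    intro α hα
    have hu1 := integrable_slice (g := g) hγ hp hb hα hg2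
    have hu2 := memLp_slice (g := g) hγ hp hb hα hg2
    have e1 : ∀ z : ℝ × ℝ, ‖synth γ r p b k g (param γ (α, z))‖ₑ ^ 2
        = (ENNReal.ofReal (2 * Real.pi))⁻¹ ^ 2 * ‖fint (slice γ r p b g α) z.2‖ₑ ^ 2 := by
      intro z
      rw [synth_param hα, enorm_mul, enorm_mul, mul_pow, mul_pow]
      have h1 : ‖Complex.exp (Complex.I * z.1) ^ k‖ₑ = 1 := by
        rw [← ofReal_norm, norm_zpow, Complex.norm_exp]; simp
      have h2 : ‖((2 * Real.pi : ℝ) : ℂ)⁻¹‖ₑ = (ENNReal.ofReal (2 * Real.pi))⁻¹ := by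
        rw [← ofReal_norm, norm_inv, Complex.norm_real, Real.norm_of_nonneg (by positivity),
          ENNReal.ofReal_inv_of_pos (by positivity)]
      rw [h1, h2, one_pow, one_mul]
    have hm : Measurable fun s => ‖fint (slice γ r p b g α) s‖ₑ ^ 2 :=
      (continuous_fint hu1).measurable.enorm.pow_const 2
    simp_rw [e1]
    have hm2 : Measurable fun z : ℝ × ℝ => ‖fint (slice γ r p b g α) z.2‖ₑ ^ 2 :=
      hm.comp measurable_snd
    rw [lintegral_const_mul _ hm2, lintegral_prod _ hm2.aemeasurable]
    simp only [lintegral_const, Measure.restrict_apply MeasurableSet.univ, Set.univ_inter,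
      Real.volume_Ico, sub_zero]
    rw [lintegral_enorm_fint_sq hu1 hu2]
    have e2 : ∫⁻ ξ, ‖slice γ r p b g α ξ‖ₑ ^ 2
        = ∫⁻ ξ, ‖(profile γ r p b α ξ : ℂ)‖ₑ ^ 2 * ‖g ξ‖ₑ ^ 2 ∂halfLine := by
      rw [← lintegral_indicator measurableSet_Ioi]
      congr 1
      ext ξ
      by_cases hξ : ξ ∈ Set.Ioi (0 : ℝ) <;> simp [hξ, slice, mul_pow]
    rw [e2]
    set c := ENNReal.ofReal (2 * Real.pi)
    have hc : c ≠ ⊤ := ENNReal.ofReal_ne_top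
    set J := ∫⁻ ξ, ‖(profile γ r p b α ξ : ℂ)‖ₑ ^ 2 * ‖g ξ‖ₑ ^ 2 ∂halfLine
    calc c⁻¹ ^ 2 * (c * J * c) = (c⁻¹ * c) * (c⁻¹ * c) * J := by ring
      _ = J := by rw [ENNReal.inv_mul_cancel hπ hc]; simp
  have hpm : Measurable fun z : ℝ × ℝ => ‖(profile γ r p b z.1 z.2 : ℂ)‖ₑ ^ 2 * ‖g z.2‖ₑ ^ 2 := by
    have := measurable_profile γ r p b
    fun_prop
  rw [lintegral_mu γ r ((measurable_synth hg2).enorm.pow_const 2),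
    lintegral_congr_ae ((ae_radial_pos r).mono fun α hα => hang α hα),
    lintegral_lintegral_swap hpm.aemeasurable]
  refine setLIntegral_congr_fun measurableSet_Ioi fun ξ hξ => ?_
  have hm1 : Measurable fun α => ‖(profile γ r p b α ξ : ℂ)‖ₑ ^ 2 := by
    unfold profile; fun_prop
  rw [lintegral_mul_const _ hm1, lintegral_profile_sq hγ hp hb hξ, one_mul]

theorem memLp_synth (hγ : 1 < γ) (hp : 0 < 2 * p + 1 + r) (hb : 0 < b) {k : ℤ}
    {g : ℝ → ℂ} (hg : MemLp g 2 halfLine) : MemLp (synth γ r p b k g) 2 (mu γ r) := by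
  refine memLp_two_of_lintegral (measurable_synth hg).aestronglyMeasurable ?_
  have hm := (Lp.stronglyMeasurable (hg.toLp g)).measurable
  rw [synth_congr hg.coeFn_toLp.symm, lintegral_enorm_synth_sq hγ hp hb hm (Lp.memLp _)]
  exact lintegral_ne_top_of_memLp_two (Lp.memLp _)

/-- Supplies the joint integrability for exchanging `α` and `ξ` in the pairing of two
superpositions. -/
theorem memLp_profile_mul_prod (hγ : 1 < γ) (hp : 0 < 2 * p + 1 + r) (hb : 0 < b)
    {g : ℝ → ℂ} (hg : Measurable g) (hg2 : MemLp g 2 halfLine) :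
    MemLp (fun z : ℝ × ℝ => (profile γ r p b z.1 z.2 : ℂ) * g z.2) 2
      ((radial r).prod halfLine) := by
  have hm : Measurable fun z : ℝ × ℝ => (profile γ r p b z.1 z.2 : ℂ) * g z.2 := by
    have := measurable_profile γ r p b
    fun_prop
  refine memLp_two_of_lintegral hm.aestronglyMeasurable ?_
  rw [lintegral_prod_symm _ (hm.enorm.pow_const 2).aemeasurable]
  refine ne_of_eq_of_ne ?_ (lintegral_ne_top_of_memLp_two hg2)
  refine setLIntegral_congr_fun measurableSet_Ioi fun ξ hξ => ?_
  have hm1 : Measurable fun α => ‖(profile γ r p b α ξ : ℂ)‖ₑ ^ 2 := by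
    unfold profile; fun_prop
  simp only [enorm_mul, mul_pow]
  rw [lintegral_mul_const _ hm1, lintegral_profile_sq hγ hp hb hξ, one_mul]

/-- The `θ`-integral selects `k = l`, Plancherel turns the `s`-integral into one over `ξ`, and the
remaining radial integral is the frequency-independent pairing. -/
theorem integral_conj_synth_mul_synth_of_measurable (hγ : 1 < γ) (hp : 0 < 2 * p + 1 + r)
    (hp' : 0 < 2 * p' + 1 + r) (hb : 0 < b) (hb' : 0 < b') (k l : ℤ) {g h : ℝ → ℂ}
    (hg : Measurable g) (hg2 : MemLp g 2 halfLine) (hh : Measurable h) (hh2 : MemLp h 2 halfLine) :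
    ∫ ζ, (starRingEnd ℂ) (synth γ r p b k g ζ) * synth γ r p' b' l h ζ ∂(mu γ r)
      = if k = l then pairing γ r p b p' b' * ∫ ξ, (starRingEnd ℂ) (g ξ) * h ξ ∂halfLine
        else 0 := by
  have hint : Integrable (fun ζ => (starRingEnd ℂ) (synth γ r p b k g ζ) * synth γ r p' b' l h ζ)
      (mu γ r) :=
    (memLp_synth hγ hp hb hg2).star.integrable_mul (memLp_synth hγ hp' hb' hh2)
  rw [integral_mu γ r hint]
  have hang : ∀ α, 0 < α → ∫ z, (starRingEnd ℂ) (synth γ r p b k g (param γ (α, z)))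
      * synth γ r p' b' l h (param γ (α, z)) ∂angular
      = (if k = l then 1 else 0) * ∫ ξ, (starRingEnd ℂ) ((profile γ r p b α ξ : ℂ) * g ξ)
        * ((profile γ r p' b' α ξ : ℂ) * h ξ) ∂halfLine := by
    intro α hα
    have hu1 := integrable_slice (g := g) hγ hp hb hα hg2
    have hu2 := memLp_slice (g := g) hγ hp hb hα hg2
    have hv1 := integrable_slice (g := h) hγ hp' hb' hα hh2
    have hv2 := memLp_slice (g := h) hγ hp' hb' hα hh2
    have e1 : ∀ z : ℝ × ℝ, (starRingEnd ℂ) (synth γ r p b k g (param γ (α, z)))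
        * synth γ r p' b' l h (param γ (α, z)) =
        ((((2 * Real.pi : ℝ) : ℂ)⁻¹) ^ 2 * Complex.exp (Complex.I * z.1) ^ (l - k)) *
        ((starRingEnd ℂ) (fint (slice γ r p b g α) z.2) * fint (slice γ r p' b' h α) z.2) := by
      intro z
      have h0 : Complex.exp (Complex.I * z.1) ≠ 0 := Complex.exp_ne_zero _
      have h1 : (starRingEnd ℂ) (Complex.exp (Complex.I * z.1) ^ k)
          = (Complex.exp (Complex.I * z.1) ^ k)⁻¹ := by
        rw [map_zpow₀, ← inv_zpow, ← Complex.exp_conj, ← Complex.exp_neg]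
        simp
      rw [synth_param hα, synth_param hα, map_mul, map_mul, h1, map_inv₀, Complex.conj_ofReal,
        zpow_sub₀ h0]
      ring
    simp_rw [e1]
    rw [integral_prod_mul (fun θ : ℝ => (((2 * Real.pi : ℝ) : ℂ)⁻¹) ^ 2 *
      Complex.exp (Complex.I * θ) ^ (l - k)) (fun s : ℝ =>
      (starRingEnd ℂ) (fint (slice γ r p b g α) s) * fint (slice γ r p' b' h α) s),
      integral_const_mul, integral_exp_angle, integral_conj_fint_mul_fint hu1 hu2 hv1 hv2]
    have e2 : ∫ ξ, (starRingEnd ℂ) (slice γ r p b g α ξ) * slice γ r p' b' h α ξ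
        = ∫ ξ, (starRingEnd ℂ) ((profile γ r p b α ξ : ℂ) * g ξ)
        * ((profile γ r p' b' α ξ : ℂ) * h ξ) ∂halfLine := by
      rw [← integral_indicator measurableSet_Ioi]
      congr 1
      ext ξ
      by_cases hξ : ξ ∈ Set.Ioi (0 : ℝ) <;> simp [hξ, slice]
    rw [e2]
    have hπ : (Real.pi : ℂ) ≠ 0 := by exact_mod_cast Real.pi_ne_zero
    by_cases hkl : k = l
    · simp only [hkl, sub_self, if_true]
      push_cast
      field_simp
    · rw [if_neg (sub_ne_zero.2 (Ne.symm hkl)), if_neg hkl]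
      simp
  rw [integral_congr_ae ((ae_radial_pos r).mono fun α hα => hang α hα), integral_const_mul]
  by_cases hkl : k = l
  · rw [if_pos hkl, if_pos hkl, one_mul]
    have hI : Integrable (Function.uncurry fun α ξ => (starRingEnd ℂ)
        ((profile γ r p b α ξ : ℂ) * g ξ) * ((profile γ r p' b' α ξ : ℂ) * h ξ))
        ((radial r).prod halfLine) :=
      (memLp_profile_mul_prod hγ hp hb hg hg2).star.integrable_mul
        (memLp_profile_mul_prod hγ hp' hb' hh hh2)
    rw [integral_integral_swap hI, ← integral_const_mul]
    refine setIntegral_congr_fun measurableSet_Ioi fun ξ hξ => ?_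
    have hξ' : 0 < ξ := hξ
    have e3 : ∀ α, (starRingEnd ℂ) ((profile γ r p b α ξ : ℂ) * g ξ)
        * ((profile γ r p' b' α ξ : ℂ) * h ξ)
        = ((profile γ r p b α ξ * profile γ r p' b' α ξ : ℝ) : ℂ)
          * ((starRingEnd ℂ) (g ξ) * h ξ) := by
      intro α
      rw [map_mul, Complex.conj_ofReal]; push_cast; ring
    simp_rw [e3]
    rw [integral_mul_const, integral_radial]
    congr 1
    rw [← integral_profile_mul_profile hγ hp hp' hb hb' hξ', ← integral_complex_ofReal]
    push_cast
    rfl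
  · rw [if_neg hkl, if_neg hkl, zero_mul]

/-- The space of square-integrable functions of the frequency. -/
abbrev Freq : Type := Lp ℂ 2 halfLine

/-- Nonzero frequency functions are what make the blocks, and hence their eigenvectors, nonzero. -/
instance : Nontrivial Freq := by
  have hs : MeasurableSet (Set.Ioc (0 : ℝ) 1) := measurableSet_Ioc
  have hv : halfLine (Set.Ioc (0 : ℝ) 1) = 1 := by
    rw [Measure.restrict_apply hs, Set.inter_eq_left.2 fun x hx => hx.1, Real.volume_Ioc]
    simp
  refine ⟨⟨indicatorConstLp 2 hs (by rw [hv]; simp) 1, 0, ?_⟩⟩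
  intro h
  have := congrArg norm h
  rw [norm_indicatorConstLp (by norm_num) (by norm_num), measureReal_def, hv] at this
  simp at this

theorem inner_toLp_synth (hγ : 1 < γ) (hp : 0 < 2 * p + 1 + r)
    (hp' : 0 < 2 * p' + 1 + r) (hb : 0 < b) (hb' : 0 < b') (k l : ℤ) (g h : Freq) :
    ⟪(memLp_synth hγ hp hb (k := k) (Lp.memLp g)).toLp _,
      (memLp_synth hγ hp' hb' (k := l) (Lp.memLp h)).toLp _⟫_ℂ
      = if k = l then pairing γ r p b p' b' * ⟪g, h⟫_ℂ else 0 := by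
  rw [L2.inner_def, L2.inner_def]
  have e : ∫ ξ, ⟪g ξ, h ξ⟫_ℂ ∂halfLine = ∫ ξ, (starRingEnd ℂ) (g ξ) * h ξ ∂halfLine := by
    congr 1; ext ξ; rw [RCLike.inner_apply, mul_comm]
  rw [e, ← integral_conj_synth_mul_synth_of_measurable hγ hp hp' hb hb' k l
    (Lp.stronglyMeasurable g).measurable (Lp.memLp g)
    (Lp.stronglyMeasurable h).measurable (Lp.memLp h)]
  apply integral_congr_ae
  filter_upwards [(memLp_synth hγ hp hb (k := k) (Lp.memLp g)).coeFn_toLp,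
    (memLp_synth hγ hp' hb' (k := l) (Lp.memLp h)).coeFn_toLp] with ζ h1 h2
  rw [h1, h2, RCLike.inner_apply, mul_comm]

theorem integrable_synth_integrand (hγ : 1 < γ) (hp : 0 < 2 * p + 1 + r) (hb : 0 < b) {α : ℝ}
    (hα : 0 < α) {g : ℝ → ℂ} (hg : MemLp g 2 halfLine) (s : ℝ) :
    Integrable (fun ξ : ℝ => (profile γ r p b α ξ : ℂ) * g ξ * Complex.exp (Complex.I * ξ * s))
      halfLine := by
  refine (integrable_profile_mul hγ hp hb hα hg).mul_bdd (c := 1) (by fun_prop)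
    (ae_of_all _ fun ξ => ?_)
  rw [Complex.norm_exp]; simp

theorem synth_add (hγ : 1 < γ) (hp : 0 < 2 * p + 1 + r) (hb : 0 < b) {k : ℤ} {g h : ℝ → ℂ}
    (hg : MemLp g 2 halfLine) (hh : MemLp h 2 halfLine) {ζ : surface γ} (hζ : 0 < ‖ζ.1.1‖) :
    synth γ r p b k (g + h) ζ = synth γ r p b k g ζ + synth γ r p b k h ζ := by
  rw [synth, synth, synth, ← mul_add,
    ← integral_add (integrable_synth_integrand hγ hp hb hζ hg _)
      (integrable_synth_integrand hγ hp hb hζ hh _)]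
  congr 1
  refine integral_congr_ae (ae_of_all _ fun ξ => ?_)
  simp only [Pi.add_apply]
  ring

theorem synth_smul {k : ℤ} {g : ℝ → ℂ} (c : ℂ) (ζ : surface γ) :
    synth γ r p b k (c • g) ζ = c * synth γ r p b k g ζ := by
  rw [synth, synth, mul_left_comm c, ← integral_const_mul c]
  congr 1
  refine integral_congr_ae (ae_of_all _ fun ξ => ?_)
  simp only [Pi.smul_apply, smul_eq_mul]
  ring

/-- The superposition operator as an isometry. -/
def synthₗᵢ (hγ : 1 < γ) (hp : 0 < 2 * p + 1 + r) (hb : 0 < b) (k : ℤ) :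
    Freq →ₗᵢ[ℂ] L2 γ r where
  toFun g := (memLp_synth hγ hp hb (k := k) (Lp.memLp g)).toLp _
  map_add' g h := by
    rw [← MemLp.toLp_add, MemLp.toLp_eq_toLp_iff]
    filter_upwards [ae_mu_pos γ r] with ζ hζ
    rw [synth_congr (Lp.coeFn_add g h), synth_add hγ hp hb (Lp.memLp g) (Lp.memLp h) hζ]
    rfl
  map_smul' c g := by
    rw [RingHom.id_apply, ← MemLp.toLp_const_smul, MemLp.toLp_eq_toLp_iff]
    filter_upwards with ζ
    rw [synth_congr (Lp.coeFn_smul c g), synth_smul]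
    rfl
  norm_map' g := by
    have h := inner_toLp_synth hγ hp hp hb hb k k g g
    rw [if_pos rfl, pairing_self hγ hp hb, inner_self_eq_norm_sq_to_K,
      inner_self_eq_norm_sq_to_K] at h
    simp only [Complex.ofReal_one, one_mul] at h
    exact (sq_eq_sq₀ (norm_nonneg _) (norm_nonneg _)).1 (by exact_mod_cast h)

theorem coeFn_synthₗᵢ (hγ : 1 < γ) (hp : 0 < 2 * p + 1 + r) (hb : 0 < b) (k : ℤ) (g : Freq) :
    synthₗᵢ hγ hp hb k g =ᵐ[mu γ r] synth γ r p b k g :=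
  MemLp.coeFn_toLp (memLp_synth hγ hp hb (Lp.memLp g))

theorem inner_synthₗᵢ (hγ : 1 < γ) (hp : 0 < 2 * p + 1 + r)
    (hp' : 0 < 2 * p' + 1 + r) (hb : 0 < b) (hb' : 0 < b') (k l : ℤ) (g h : Freq) :
    ⟪synthₗᵢ hγ hp hb k g, synthₗᵢ hγ hp' hb' l h⟫_ℂ
      = if k = l then pairing γ r p b p' b' * ⟪g, h⟫_ℂ else 0 :=
  inner_toLp_synth hγ hp hp' hb hb' k l g h

end

/-! ### The two families of embeddings and the Leray kernel -/

section

open scoped InnerProductSpace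

variable {γ r : ℝ}

/-- The power of `α` in the profile dual to `α ^ k e ^ (-ξ α ^ γ)`. -/
def dualPower (γ r : ℝ) (k : ℕ) : ℝ := (k + 1) * (γ - 1) - r

/-- The two ends of the interval for `r` are the square-integrability conditions at `k = 0`: `r >
-1` for the left profile and `r < 2γ - 1` for its dual. -/
theorem admissible_left (hr : -1 < r) (k : ℕ) : 0 < 2 * (k : ℝ) + 1 + r := by
  have : (0 : ℝ) ≤ k := k.cast_nonneg
  linarith

theorem admissible_right (hγ : 1 < γ) (hr : r < 2 * γ - 1) (k : ℕ) :
    0 < 2 * dualPower γ r k + 1 + r := by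
  have : (0 : ℝ) ≤ k * (γ - 1) := mul_nonneg k.cast_nonneg (by linarith)
  rw [dualPower]
  linarith

theorem expo_dualPower (hγ : 1 < γ) (k : ℕ) :
    expo γ r (dualPower γ r k) = 2 * k + 2 - (2 * k + 1 + r) / γ := by
  have : γ ≠ 0 := by linarith
  rw [expo, dualPower]
  field_simp
  ring

/-- This makes the mixed Gamma factor `k!` and the combined power of the frequency `ξ^(k+1)`, as the
Leray kernel requires. -/
theorem expo_add_expo_dualPower (hγ : 1 < γ) (k : ℕ) :
    (expo γ r k + expo γ r (dualPower γ r k)) / 2 = k + 1 := by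
  rw [expo_dualPower hγ, expo]; ring

/-- The pairing of the `k`-th profile with its dual. -/
def pairCoeff (γ r : ℝ) (k : ℕ) : ℝ := pairing γ r k 1 (dualPower γ r k) (γ - 1)

theorem pairCoeff_eq (hγ : 1 < γ) (k : ℕ) : pairCoeff γ r k =
    √(γ * (2 * 1) ^ expo γ r k / Real.Gamma (expo γ r k))
      * √(γ * (2 * (γ - 1)) ^ expo γ r (dualPower γ r k) / Real.Gamma (expo γ r (dualPower γ r k)))
      * (k.factorial / γ ^ (k + 2)) := by
  have hγ0 : 0 < γ := by linarith
  rw [pairCoeff, pairing, expo_add_expo_dualPower hγ, Real.Gamma_nat_eq_factorial]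
  congr 2
  rw [show (1 : ℝ) + (γ - 1) = γ by ring, show ((k : ℝ) + 1) = ((k + 1 : ℕ) : ℝ) by push_cast; ring,
    Real.rpow_natCast]
  ring

theorem norm_const_pos (hγ : 1 < γ) {p b : ℝ} (hp : 0 < 2 * p + 1 + r) (hb : 0 < b) :
    0 < √(γ * (2 * b) ^ expo γ r p / Real.Gamma (expo γ r p)) := by
  have := Real.Gamma_pos_of_pos (expo_pos (γ := γ) hγ hp)
  have hγ0 : 0 < γ := by linarith
  exact Real.sqrt_pos.2 (by positivity)

theorem pairCoeff_pos (hγ : 1 < γ) (hr : r ∈ Set.Ioo (-1 : ℝ) (2 * γ - 1)) (k : ℕ) :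
    0 < pairCoeff γ r k := by
  rw [pairCoeff_eq hγ]
  have h1 := norm_const_pos (b := 1) hγ (admissible_left hr.1 k) one_pos
  have h2 := norm_const_pos (b := γ - 1) hγ (admissible_right hγ hr.2 k) (by linarith)
  have hγ0 : 0 < γ := by linarith
  have h3 : (0 : ℝ) < k.factorial := by exact_mod_cast k.factorial_pos
  positivity

theorem inv_pairCoeff_sq (hγ : 1 < γ) (hr : r ∈ Set.Ioo (-1 : ℝ) (2 * γ - 1)) (k : ℕ) :
    ((pairCoeff γ r k)⁻¹) ^ 2 = symbol γ r k := by
  have hγ0 : 0 < γ := by linarith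
  have hγ1 : 0 < γ - 1 := by linarith
  have hx := expo_pos hγ (admissible_left hr.1 k)
  have hy := expo_pos hγ (admissible_right hγ hr.2 k)
  have hΓx := Real.Gamma_pos_of_pos hx
  have hΓy := Real.Gamma_pos_of_pos hy
  have hk : (0 : ℝ) < k.factorial := by exact_mod_cast k.factorial_pos
  rw [pairCoeff_eq hγ, symbol, ← expo_dualPower hγ, Real.Gamma_nat_eq_factorial,
    show (2 * (k : ℝ) + 1 + r) / γ = expo γ r k from rfl]
  have hxy : expo γ r k + expo γ r (dualPower γ r k) = ((2 * k + 2 : ℕ) : ℝ) := by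
    have := expo_add_expo_dualPower (r := r) hγ k
    push_cast; linarith
  set x := expo γ r k
  set y := expo γ r (dualPower γ r k)
  -- Since `x + y = 2k + 2`, the two real powers of `2` merge into the integer power in the symbol.
  have h2 : (2 : ℝ) ^ x * 2 ^ y = 2 ^ (2 * k + 2) := by
    rw [← Real.rpow_add two_pos, hxy, Real.rpow_natCast]
  rw [inv_pow, mul_pow, mul_pow, Real.sq_sqrt (by positivity), Real.sq_sqrt (by positivity),
    mul_one, Real.mul_rpow two_pos.le hγ1.le, Real.rpow_neg hγ1.le, div_pow γ 2, ← h2]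
  have e1 : (0 : ℝ) < 2 ^ x := by positivity
  have e2 : (0 : ℝ) < 2 ^ y := by positivity
  have e3 : (0 : ℝ) < (γ - 1) ^ y := by positivity
  field_simp
  ring

/-- The embeddings along the profiles `α ^ k e ^ (-ξ α ^ γ)`. -/
def embLeft (hγ : 1 < γ) (hr : r ∈ Set.Ioo (-1 : ℝ) (2 * γ - 1)) (k : ℕ) : Freq →ₗᵢ[ℂ] L2 γ r :=
  synthₗᵢ hγ (admissible_left hr.1 k) one_pos k

/-- The embeddings along the dual profiles. -/
def embRight (hγ : 1 < γ) (hr : r ∈ Set.Ioo (-1 : ℝ) (2 * γ - 1)) (k : ℕ) : Freq →ₗᵢ[ℂ] L2 γ r :=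
  synthₗᵢ hγ (admissible_right hγ hr.2 k) (sub_pos.2 hγ) k

/-- Different indices are orthogonal through the angular factor `e^{ikθ}` alone; the uniform bound
on `(κ k)⁻¹` is the boundedness of the symbol. -/
theorem isBiorthogonal (hγ : 1 < γ) (hr : r ∈ Set.Ioo (-1 : ℝ) (2 * γ - 1)) :
    IsBiorthogonal (embLeft hγ hr) (embRight hγ hr) (pairCoeff γ r) where
  left j k hjk g h := by
    rw [embLeft, embLeft, inner_synthₗᵢ, if_neg (by exact_mod_cast hjk)]
  right j k hjk g h := by
    rw [embRight, embRight, inner_synthₗᵢ, if_neg (by exact_mod_cast hjk)]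
  inner_same k g h := by
    rw [embLeft, embRight, inner_synthₗᵢ, if_pos rfl, pairCoeff]
  inner_ne j k g h hjk := by
    rw [embLeft, embRight, inner_synthₗᵢ, if_neg (by exact_mod_cast hjk)]
  pos := pairCoeff_pos hγ hr
  bounded := by
    obtain ⟨C, hC⟩ := exists_symbol_le (r := r) hγ
    refine ⟨√C, fun k => Real.le_sqrt_of_sq_le ?_⟩
    rw [inv_pairCoeff_sq hγ hr]
    exact hC k

theorem exists_orthogonal (hγ : 1 < γ) (hr : r ∈ Set.Ioo (-1 : ℝ) (2 * γ - 1)) :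
    ∃ v : L2 γ r, v ≠ 0 ∧ ∀ k g, ⟪embLeft hγ hr k g, v⟫_ℂ = 0 ∧ ⟪embRight hγ hr k g, v⟫_ℂ = 0 := by
  obtain ⟨g, hg⟩ := exists_ne (0 : Freq)
  have h0 : 0 < 2 * (0 : ℝ) + 1 + r := by linarith [hr.1]
  -- Angular frequency `-1` is orthogonal to every `k ≥ 0`; the radial profile chosen is immaterial.
  refine ⟨synthₗᵢ hγ h0 one_pos (-1) g, ?_, fun k g' => ⟨?_, ?_⟩⟩
  · exact fun h => hg ((synthₗᵢ hγ h0 one_pos (-1)).injective (by rw [h, map_zero]))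
  · rw [embLeft, inner_synthₗᵢ, if_neg (by omega)]
  · rw [embRight, inner_synthₗᵢ, if_neg (by omega)]

/-- The kernel is a density against `σ = μ_{γ-1}`, while the pairings live in `L²(μ_r)`; this
provides the conversion factor `α^(γ-1-r)`. -/
theorem mu_eq_withDensity (γ r r' : ℝ) : mu γ r' =
    (mu γ r).withDensity fun ζ => ENNReal.ofReal (‖ζ.1.1‖ ^ (r' - r)) := by
  have hd : Measurable fun ζ : surface γ => ENNReal.ofReal (‖ζ.1.1‖ ^ (r' - r)) := by fun_prop
  ext s hs
  have hind : Measurable (s.indicator (1 : surface γ → ENNReal)) := measurable_one.indicator hs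
  have hin : Measurable fun α : ℝ => ∫⁻ z, s.indicator 1 (param γ (α, z)) ∂angular :=
    (hind.comp (measurable_param γ)).lintegral_prod_right'
  have hout : Measurable fun α : ℝ => ENNReal.ofReal (α ^ (r' - r))
      * ∫⁻ z, s.indicator 1 (param γ (α, z)) ∂angular := by
    exact (measurable_ofReal_rpow _).mul hin
  rw [withDensity_apply _ hs, ← lintegral_indicator hs, ← lintegral_indicator_one hs,
    lintegral_mu γ r' hind, lintegral_mu γ r (hd.indicator hs)]
  have e : ∫⁻ α, ∫⁻ z, s.indicator (fun ζ : surface γ => ENNReal.ofReal (‖ζ.1.1‖ ^ (r' - r)))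
      (param γ (α, z)) ∂angular ∂(radial r) = ∫⁻ α, ENNReal.ofReal (α ^ (r' - r))
      * ∫⁻ z, s.indicator 1 (param γ (α, z)) ∂angular ∂(radial r) := by
    refine lintegral_congr_ae ((ae_radial_pos r).mono fun α hα => ?_)
    have hc : Measurable fun z : ℝ × ℝ => s.indicator (1 : surface γ → ENNReal) (param γ (α, z)) :=
      hind.comp ((measurable_param γ).comp measurable_prodMk_left)
    simp only
    rw [← lintegral_const_mul _ hc]
    congr 1
    ext z
    have h1 : ‖(param γ (α, z)).1.1‖ = α := by simp [param, Complex.norm_exp, hα.le]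
    by_cases hz : param γ (α, z) ∈ s <;> simp [hz, h1]
  rw [e, lintegral_withDensity_eq_lintegral_mul _ (measurable_ofReal_rpow r') hin,
    lintegral_withDensity_eq_lintegral_mul _ (measurable_ofReal_rpow r) hout]
  refine setLIntegral_congr_fun measurableSet_Ioi fun α hα => ?_
  have hα' : 0 < α := hα
  simp only [Pi.mul_apply]
  rw [← mul_assoc, ← ENNReal.ofReal_mul (by positivity), ← Real.rpow_add hα', add_sub_cancel]

theorem integrable_sigma_iff (γ r r' : ℝ) (F : surface γ → ℂ) :
    Integrable F (mu γ r') ↔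
      Integrable (fun ζ => ((‖ζ.1.1‖ ^ (r' - r) : ℝ) : ℂ) * F ζ) (mu γ r) := by
  rw [mu_eq_withDensity γ r r', integrable_withDensity_iff_integrable_smul' (by fun_prop)
    (ae_of_all _ fun _ => ENNReal.ofReal_lt_top)]
  refine integrable_congr (ae_of_all _ fun ζ => ?_)
  simp only
  rw [ENNReal.toReal_ofReal (by positivity), Complex.real_smul]

theorem integral_sigma (γ r r' : ℝ) (F : surface γ → ℂ) :
    ∫ ζ, F ζ ∂(mu γ r') = ∫ ζ, ((‖ζ.1.1‖ ^ (r' - r) : ℝ) : ℂ) * F ζ ∂(mu γ r) := by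
  rw [mu_eq_withDensity γ r r', integral_withDensity_eq_integral_toReal_smul (by fun_prop)
    (ae_of_all _ fun _ => ENNReal.ofReal_lt_top)]
  congr 1
  ext ζ
  rw [ENNReal.toReal_ofReal (by positivity), Complex.real_smul]

/-- The part of the denominator of the Leray kernel that is independent of `z₁`. -/
def denomA (γ : ℝ) (w : ℂ) (ζ : surface γ) : ℂ :=
  (((γ - 1) * ‖ζ.1.1‖ ^ γ : ℝ) : ℂ) + Complex.I * (ζ.1.2.re - w)

/-- The part of the denominator of the Leray kernel that is linear in `z₁`. -/
def denomB (γ : ℝ) (w : ℂ) (ζ : surface γ) : ℂ :=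
  γ * (starRingEnd ℂ) ζ.1.1 * ((‖ζ.1.1‖ ^ (γ - 2) : ℝ) : ℂ) * w

/-- On `M_γ` the term `iζ₂` contributes `-α^γ`, which turns `γα^γ` into `(γ-1)α^γ`. -/
theorem kernel_eq (z : ℂ × ℂ) {ζ : surface γ} (hζ : 0 < ‖ζ.1.1‖) :
    kernel γ z ζ = ((γ ^ 2 / (4 * Real.pi ^ 2) : ℝ) : ℂ) /
      (denomA γ z.2 ζ - denomB γ z.1 ζ) ^ 2 := by
  rw [kernel]
  congr 2
  have h1 : (starRingEnd ℂ) ζ.1.1 * ζ.1.1 * ((‖ζ.1.1‖ ^ (γ - 2) : ℝ) : ℂ)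
      = ((‖ζ.1.1‖ ^ γ : ℝ) : ℂ) := by
    rw [Complex.conj_mul', ← Complex.ofReal_pow, ← Complex.ofReal_mul, ← Real.rpow_natCast,
      ← Real.rpow_add hζ]
    congr 2; push_cast; ring
  have h2 : ζ.1.2 = ζ.1.2.re + ((‖ζ.1.1‖ ^ γ : ℝ) : ℂ) * Complex.I := by
    have h3 : ζ.1.2.im = ‖ζ.1.1‖ ^ γ := ζ.2
    rw [← h3, Complex.re_add_im]
  rw [denomA, denomB]
  calc _ = (γ : ℂ) * ((starRingEnd ℂ) ζ.1.1 * ζ.1.1 * ((‖ζ.1.1‖ ^ (γ - 2) : ℝ) : ℂ))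
        - γ * (starRingEnd ℂ) ζ.1.1 * ((‖ζ.1.1‖ ^ (γ - 2) : ℝ) : ℂ) * z.1
        + Complex.I * (ζ.1.2 - z.2) := by ring
    _ = _ := by
      rw [h1]
      rw [Complex.ofReal_mul, Complex.ofReal_sub, Complex.ofReal_one]
      linear_combination Complex.I * h2 + ((‖ζ.1.1‖ ^ γ : ℝ) : ℂ) * Complex.I_mul_I

theorem re_denomA (w : ℂ) (ζ : surface γ) :
    (denomA γ w ζ).re = (γ - 1) * ‖ζ.1.1‖ ^ γ + w.im := by
  simp [denomA]

theorem re_denomA_pos (hγ : 1 < γ) {w : ℂ} (hw : 0 < w.im) (ζ : surface γ) :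
    0 < (denomA γ w ζ).re := by
  rw [re_denomA]
  have : 0 ≤ (γ - 1) * ‖ζ.1.1‖ ^ γ := mul_nonneg (by linarith) (by positivity)
  linarith

theorem im_pos_of_mem_domain {z : ℂ × ℂ} (hz : z ∈ domain γ) : 0 < z.2.im :=
  lt_of_le_of_lt (by positivity) (show ‖z.1‖ ^ γ < z.2.im from hz)

/-- With `Y = (Im z₂)^(1/γ)`, Young's inequality for the exponents `γ` and `γ/(γ-1)` gives `γ
α^(γ-1) Y ≤ Im z₂ + (γ-1) α^γ`, the real part of `denomA`. The ratio is thus at most `|z₁|/Y`, which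
is below `1` exactly on `Ω_γ`. -/
theorem exists_denom_le (hγ : 1 < γ) {z : ℂ × ℂ} (hz : z ∈ domain γ) :
    ∃ c, 0 ≤ c ∧ c < 1 ∧ ∀ ζ : surface γ, 0 < ‖ζ.1.1‖ →
      ‖denomB γ z.1 ζ‖ ≤ c * ‖denomA γ z.2 ζ‖ := by
  have hy := im_pos_of_mem_domain hz
  have hγ0 : 0 < γ := by linarith
  set Y := z.2.im ^ γ⁻¹ with hY
  have hY0 : 0 < Y := by positivity
  have hYγ : Y ^ γ = z.2.im := by rw [hY, Real.rpow_inv_rpow hy.le hγ0.ne']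
  have hzY : ‖z.1‖ < Y := by
    have h1 : ‖z.1‖ ^ γ < Y ^ γ := by rw [hYγ]; exact hz
    exact (Real.rpow_lt_rpow_iff (norm_nonneg _) hY0.le hγ0).1 h1
  refine ⟨‖z.1‖ / Y, by positivity, (div_lt_one hY0).2 hzY, fun ζ hζ => ?_⟩
  set α := ‖ζ.1.1‖ with hα
  have hB : ‖denomB γ z.1 ζ‖ = γ * α ^ (γ - 1) * ‖z.1‖ := by
    rw [denomB, norm_mul, norm_mul, norm_mul, Complex.norm_real, Complex.norm_real,
      RCLike.norm_conj, Real.norm_of_nonneg hγ0.le, Real.norm_of_nonneg (by positivity), ← hα,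
      mul_assoc γ, show γ - 1 = 1 + (γ - 2) by ring, Real.rpow_add hζ, Real.rpow_one]
  have hpq : γ.HolderConjugate (γ / (γ - 1)) := Real.HolderConjugate.conjExponent hγ
  have hyoung := Real.young_inequality_of_nonneg hY0.le (b := α ^ (γ - 1)) (by positivity) hpq
  have hγ1 : γ - 1 ≠ 0 := by linarith
  rw [← Real.rpow_mul hζ.le, mul_div_cancel₀ _ hγ1, hYγ] at hyoung
  have hA : γ * α ^ (γ - 1) * Y ≤ ‖denomA γ z.2 ζ‖ := by
    refine le_trans ?_ (Complex.re_le_norm _)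
    rw [re_denomA, ← hα]
    calc γ * α ^ (γ - 1) * Y = γ * (Y * α ^ (γ - 1)) := by ring
      _ ≤ γ * (z.2.im / γ + α ^ γ / (γ / (γ - 1))) := by gcongr
      _ = _ := by field_simp; ring
  calc _ = ‖z.1‖ / Y * (γ * α ^ (γ - 1) * Y) := by rw [hB]; field_simp
    _ ≤ _ := by gcongr

theorem hasSum_inv_sub_sq {a b : ℂ} (h : ‖b‖ < ‖a‖) :
    HasSum (fun k : ℕ => ((k : ℂ) + 1) * b ^ k / a ^ (k + 2)) (1 / (a - b) ^ 2) := by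
  have ha : a ≠ 0 := norm_pos_iff.1 ((norm_nonneg b).trans_lt h)
  have hab : a - b ≠ 0 := fun h0 => by rw [sub_eq_zero.1 h0] at h; exact lt_irrefl _ h
  have hq : ‖b / a‖ < 1 := by rw [norm_div]; exact (div_lt_one (norm_pos_iff.2 ha)).2 h
  have h1 := (hasSum_choose_mul_geometric_of_norm_lt_one 1 hq).mul_left (1 / a ^ 2)
  have e1 : ∀ k : ℕ, ((k : ℂ) + 1) * b ^ k / a ^ (k + 2)
      = 1 / a ^ 2 * (((k + 1).choose 1 : ℕ) * (b / a) ^ k) := by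
    intro k
    rw [Nat.choose_one_right, div_pow]
    push_cast
    field_simp
    ring
  have e2 : 1 / (a - b) ^ 2 = 1 / a ^ 2 * (1 / (1 - b / a) ^ (1 + 1)) := by
    have : 1 - b / a = (a - b) / a := by field_simp
    rw [this, div_pow]
    field_simp
    ring
  rw [e2]
  simpa only [e1] using h1

theorem hasSum_norm_inv_sub_sq {a b : ℂ} (h : ‖b‖ < ‖a‖) :
    HasSum (fun k : ℕ => ‖((k : ℂ) + 1) * b ^ k / a ^ (k + 2)‖) (1 / (‖a‖ - ‖b‖) ^ 2) := by
  have ha : 0 < ‖a‖ := (norm_nonneg b).trans_lt h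
  have hq : ‖‖b‖ / ‖a‖‖ < 1 := by
    rw [Real.norm_of_nonneg (by positivity)]; exact (div_lt_one ha).2 h
  have hab : ‖a‖ - ‖b‖ ≠ 0 := (sub_pos.2 h).ne'
  have h1 := (hasSum_choose_mul_geometric_of_norm_lt_one 1 hq).mul_left (1 / ‖a‖ ^ 2)
  have e1 : ∀ k : ℕ, ‖((k : ℂ) + 1) * b ^ k / a ^ (k + 2)‖
      = 1 / ‖a‖ ^ 2 * (((k + 1).choose 1 : ℕ) * (‖b‖ / ‖a‖) ^ k) := by
    intro k
    have hk : ‖(k : ℂ) + 1‖ = (k : ℝ) + 1 := by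
      rw [← Nat.cast_succ, Complex.norm_natCast, Nat.cast_succ]
    rw [Nat.choose_one_right, norm_div, norm_mul, norm_pow, norm_pow, hk, div_pow]
    push_cast
    field_simp
    ring
  have e2 : 1 / (‖a‖ - ‖b‖) ^ 2 = 1 / ‖a‖ ^ 2 * (1 / (1 - ‖b‖ / ‖a‖) ^ (1 + 1)) := by
    have : 1 - ‖b‖ / ‖a‖ = (‖a‖ - ‖b‖) / ‖a‖ := by field_simp
    rw [this, div_pow]
    field_simp
    ring
  rw [e2]
  simpa only [e1] using h1

end

/-! ### Expansion of the Leray kernel -/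

section

open scoped InnerProductSpace

variable {γ r : ℝ}

theorem integrableOn_pow_mul_exp (n : ℕ) {w : ℂ} (hw : 0 < w.re) :
    IntegrableOn (fun t : ℝ => (t : ℂ) ^ n * Complex.exp (-(w * t))) (Set.Ioi 0) := by
  have h := integrableOn_rpow_mul_exp_neg_mul_rpow (s := n) (p := 1) (b := w.re)
    (by have : (0 : ℝ) ≤ n := n.cast_nonneg
        linarith) one_pos hw
  refine h.mono' (by fun_prop) ((ae_restrict_mem measurableSet_Ioi).mono fun t ht => ?_)
  have ht' : 0 < t := ht
  rw [norm_mul, norm_pow, Complex.norm_real, Real.norm_of_nonneg ht'.le, Complex.norm_exp,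
    Real.rpow_natCast, Real.rpow_one]
  simp

/-- The Gamma integral at complex rate `w`, by repeated integration by parts. -/
theorem integral_pow_mul_exp (n : ℕ) {w : ℂ} (hw : 0 < w.re) :
    ∫ t : ℝ in Set.Ioi 0, (t : ℂ) ^ n * Complex.exp (-(w * t)) = n.factorial / w ^ (n + 1) := by
  have hw0 : w ≠ 0 := fun h => by simp [h] at hw
  induction n with
  | zero =>
    have := integral_exp_mul_complex_Ioi (a := -w) (by simpa using hw) 0
    simp only [pow_zero, one_mul, ← neg_mul]
    rw [this]
    simp
  | succ n ih =>
    have hu : ∀ x ∈ Set.Ioi (0 : ℝ), HasDerivAt (fun t : ℝ => (t : ℂ) ^ (n + 1))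
        (((n : ℂ) + 1) * (x : ℂ) ^ n) x := by
      intro x _
      have := (hasDerivAt_pow (n + 1) (x : ℂ)).comp_ofReal
      simpa using this
    have hv : ∀ x ∈ Set.Ioi (0 : ℝ), HasDerivAt (fun t : ℝ => -(Complex.exp (-(w * t)) / w))
        (Complex.exp (-(w * x))) x := by
      intro x _
      have h1 : HasDerivAt (fun t : ℂ => -(w * t)) (-w) (x : ℂ) :=
        ((hasDerivAt_id' (x : ℂ)).const_mul w).neg.congr_deriv (by simp)
      have h2 : HasDerivAt (fun t : ℝ => -(Complex.exp (-(w * t)) / w))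
          (-(Complex.exp (-(w * x)) * -w / w)) x := (h1.cexp.div_const w).neg.comp_ofReal
      exact h2.congr_deriv (by field_simp)
    have hi := integrableOn_pow_mul_exp n hw
    have hi' := integrableOn_pow_mul_exp (n + 1) hw
    have hcont : Continuous fun t : ℝ => (t : ℂ) ^ (n + 1) * -(Complex.exp (-(w * t)) / w) := by
      fun_prop
    have h0 : Tendsto ((fun t : ℝ => (t : ℂ) ^ (n + 1)) *
        fun t : ℝ => -(Complex.exp (-(w * t)) / w)) (𝓝[>] 0) (𝓝 0) := by
      refine ((hcont.tendsto' 0 0 ?_).mono_left nhdsWithin_le_nhds)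
      simp
    have hinf : Tendsto ((fun t : ℝ => (t : ℂ) ^ (n + 1)) *
        fun t : ℝ => -(Complex.exp (-(w * t)) / w)) atTop (𝓝 0) := by
      have h1 := tendsto_rpow_mul_exp_neg_mul_atTop_nhds_zero (n + 1 : ℕ) w.re hw
      rw [tendsto_zero_iff_norm_tendsto_zero]
      have h2 := h1.mul_const ‖w‖⁻¹
      rw [zero_mul] at h2
      refine h2.congr' ((eventually_ge_atTop 0).mono fun t ht => ?_)
      simp only [Pi.mul_apply]
      rw [norm_mul, norm_neg, norm_div, norm_pow, Complex.norm_real, Real.norm_of_nonneg ht,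
        Complex.norm_exp, Real.rpow_natCast]
      simp
      ring
    have e : ∀ x : ℝ, ((n : ℂ) + 1) * (x : ℂ) ^ n * -(Complex.exp (-(w * x)) / w)
        = -(((n : ℂ) + 1) / w) * ((x : ℂ) ^ n * Complex.exp (-(w * x))) := by
      intro x; ring
    rw [integral_Ioi_mul_deriv_eq_deriv_mul hu hv hi' ?_ h0 hinf]
    · simp_rw [e]
      rw [integral_const_mul, ih, Nat.factorial_succ]
      push_cast
      field_simp
      ring
    · refine (hi.const_mul (-(((n : ℂ) + 1) / w))).congr (ae_of_all _ fun x => ?_)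
      exact (e x).symm

/-- The functional `h ↦ ∫ conj (probe z k) h` evaluates the holomorphic extension of the `k`-th
left embedding of `h` at `z`. -/
def probe (γ r : ℝ) (z : ℂ × ℂ) (k : ℕ) (ξ : ℝ) : ℂ :=
  ((2 * Real.pi : ℝ) : ℂ)⁻¹ * ((√(γ * (2 * 1) ^ expo γ r k / Real.Gamma (expo γ r k)) : ℝ) : ℂ)
    * (starRingEnd ℂ) z.1 ^ k * ((ξ ^ (expo γ r k / 2) : ℝ) : ℂ)
    * Complex.exp (-(Complex.I * (starRingEnd ℂ) z.2 * ξ))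

theorem memLp_probe (hγ : 1 < γ) (hr : -1 < r) {z : ℂ × ℂ} (hz : 0 < z.2.im) (k : ℕ) :
    MemLp (probe γ r z k) 2 halfLine := by
  have hq := expo_pos hγ (admissible_left hr k)
  have h1 : MemLp (fun ξ : ℝ => ((ξ ^ (expo γ r k / 2) * Real.exp (-(z.2.im * ξ)) : ℝ) : ℂ)) 2
      halfLine := by
    rw [memLp_two_iff_integrable_sq_norm (by fun_prop)]
    have hi := integrableOn_rpow_mul_exp_neg_mul_rpow (s := expo γ r k) (p := 1)
      (b := 2 * z.2.im) (by linarith) one_pos (by positivity)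
    refine hi.congr ((ae_restrict_mem measurableSet_Ioi).mono fun ξ hξ => ?_)
    have hξ' : 0 < ξ := hξ
    simp only
    rw [Complex.norm_real, Real.norm_eq_abs, sq_abs, mul_pow, ← Real.rpow_natCast,
      ← Real.rpow_mul hξ'.le, ← Real.exp_nat_mul, Real.rpow_one]
    congr 2 <;> push_cast <;> ring
  refine MemLp.of_le_mul (c := ‖((2 * Real.pi : ℝ) : ℂ)⁻¹ *
    ((√(γ * (2 * 1) ^ expo γ r k / Real.Gamma (expo γ r k)) : ℝ) : ℂ)
    * (starRingEnd ℂ) z.1 ^ k‖) h1 (by unfold probe; fun_prop) (ae_of_all _ fun ξ => ?_)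
  rw [probe, mul_assoc _ (Complex.ofReal _) (Complex.exp _), norm_mul]
  gcongr
  rw [norm_mul, Complex.ofReal_mul, norm_mul, Complex.norm_exp, Complex.norm_real (Real.exp _),
    Real.norm_of_nonneg (Real.exp_pos _).le]
  simp

/-- The `k`-th term of the expansion of the Leray kernel, as a density with respect to `μ_r`. -/
def kernelTerm (γ r : ℝ) (z : ℂ × ℂ) (k : ℕ) (ζ : surface γ) : ℂ :=
  ((‖ζ.1.1‖ ^ (γ - 1 - r) : ℝ) : ℂ) * (((γ ^ 2 / (4 * Real.pi ^ 2) : ℝ) : ℂ) *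
    (((k : ℂ) + 1) * denomB γ z.1 ζ ^ k / denomA γ z.2 ζ ^ (k + 2)))

/-- Profile and probe multiply to `ξ^(k+1)` times an exponential whose rate is the conjugate of
`denomA`, so the frequency integral is a Gamma integral. -/
theorem synth_probe (hγ : 1 < γ) {z : ℂ × ℂ} (hz : 0 < z.2.im) (k : ℕ)
    (ζ : surface γ) :
    synth γ r (dualPower γ r k) (γ - 1) k (probe γ r z k) ζ
      = (ζ.1.1 / ‖ζ.1.1‖) ^ k * ((2 * Real.pi : ℝ) : ℂ)⁻¹ ^ 2 *
        ((√(γ * (2 * 1) ^ expo γ r k / Real.Gamma (expo γ r k))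
        * √(γ * (2 * (γ - 1)) ^ expo γ r (dualPower γ r k) /
          Real.Gamma (expo γ r (dualPower γ r k))) * ‖ζ.1.1‖ ^ dualPower γ r k : ℝ) : ℂ)
        * (starRingEnd ℂ) z.1 ^ k
        * ((k + 1).factorial / (starRingEnd ℂ) (denomA γ z.2 ζ) ^ (k + 2)) := by
  have hA : 0 < ((starRingEnd ℂ) (denomA γ z.2 ζ)).re := by
    rw [Complex.conj_re]; exact re_denomA_pos hγ hz ζ
  rw [← integral_pow_mul_exp (k + 1) hA, synth, zpow_natCast]
  set M := √(γ * (2 * (γ - 1)) ^ expo γ r (dualPower γ r k) /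
          Real.Gamma (expo γ r (dualPower γ r k))) with hM
  set N := √(γ * (2 * 1) ^ expo γ r k / Real.Gamma (expo γ r k)) with hN
  have e : ∀ ξ ∈ Set.Ioi (0 : ℝ), (profile γ r (dualPower γ r k) (γ - 1) ‖ζ.1.1‖ ξ : ℂ)
      * probe γ r z k ξ * Complex.exp (Complex.I * ξ * ζ.1.2.re)
      = (((2 * Real.pi : ℝ) : ℂ)⁻¹ * ((N * M * ‖ζ.1.1‖ ^ dualPower γ r k : ℝ) : ℂ)
        * (starRingEnd ℂ) z.1 ^ k) *
        ((ξ : ℂ) ^ (k + 1) * Complex.exp (-((starRingEnd ℂ) (denomA γ z.2 ζ) * ξ))) := by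
    intro ξ hξ
    have hξ' : 0 < ξ := hξ
    have e1 : (ξ : ℂ) ^ (k + 1) = ((ξ ^ (expo γ r (dualPower γ r k) / 2) : ℝ) : ℂ)
        * ((ξ ^ (expo γ r k / 2) : ℝ) : ℂ) := by
      rw [← Complex.ofReal_mul, ← Real.rpow_add hξ', ← Complex.ofReal_pow, ← Real.rpow_natCast]
      congr 2
      have := expo_add_expo_dualPower (r := r) hγ k
      push_cast
      linarith
    have e2 : Complex.exp (-((starRingEnd ℂ) (denomA γ z.2 ζ) * ξ))
        = ((Real.exp (-((γ - 1) * ξ * ‖ζ.1.1‖ ^ γ)) : ℝ) : ℂ)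
          * Complex.exp (-(Complex.I * (starRingEnd ℂ) z.2 * ξ))
          * Complex.exp (Complex.I * ξ * ζ.1.2.re) := by
      rw [Complex.ofReal_exp, ← Complex.exp_add, ← Complex.exp_add]
      congr 1
      rw [denomA, map_add, map_mul, map_sub, Complex.conj_ofReal, Complex.conj_ofReal,
        Complex.conj_I]
      simp only [Complex.ofReal_mul, Complex.ofReal_neg]
      ring
    rw [e1, e2, profile, probe, ← hM, ← hN]
    simp only [Complex.ofReal_mul]
    ring
  rw [setIntegral_congr_fun measurableSet_Ioi e, integral_const_mul]
  ring

/-- The identity behind the factorization of `L`: the `k`-th kernel term is the conjugate of a dual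
superposition, so integrating against it applies `(κ k)⁻¹ (Ψ k)†` and then evaluates at `z`. -/
theorem inv_pairCoeff_mul_conj_synth_probe (hγ : 1 < γ)
    (hr : r ∈ Set.Ioo (-1 : ℝ) (2 * γ - 1)) {z : ℂ × ℂ} (hz : 0 < z.2.im) (k : ℕ)
    {ζ : surface γ} (hζ : 0 < ‖ζ.1.1‖) :
    ((pairCoeff γ r k : ℂ))⁻¹ *
      (starRingEnd ℂ) (synth γ r (dualPower γ r k) (γ - 1) k (probe γ r z k) ζ)
      = kernelTerm γ r z k ζ := by
  have hγ0 : 0 < γ := by linarith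
  have hM := norm_const_pos (b := γ - 1) hγ (admissible_right hγ hr.2 k) (by linarith)
  have hN := norm_const_pos (b := 1) hγ (admissible_left hr.1 k) one_pos
  rw [synth_probe hγ hz k ζ, pairCoeff_eq hγ, kernelTerm, denomB]
  set M := √(γ * (2 * (γ - 1)) ^ expo γ r (dualPower γ r k) /
          Real.Gamma (expo γ r (dualPower γ r k)))
  set N := √(γ * (2 * 1) ^ expo γ r k / Real.Gamma (expo γ r k))
  have hA0 : denomA γ z.2 ζ ≠ 0 := fun h => by
    have := re_denomA_pos hγ hz ζ
    rw [h] at this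
    exact lt_irrefl _ this
  simp only [map_mul, map_pow, map_div₀, map_inv₀, Complex.conj_ofReal, Complex.conj_conj,
    map_natCast]
  set α := ‖ζ.1.1‖
  -- The dual power collects the density `α^(γ-1-r)`, the `k` factors `α^(γ-2)` of `denomB ^ k`, and
  -- the modulus of `k` factors of the conjugate of `ζ₁`.
  have hpow : α ^ dualPower γ r k = α ^ (γ - 1 - r) * (α ^ (γ - 2)) ^ k * α ^ k := by
    rw [← Real.rpow_natCast, ← Real.rpow_natCast, ← Real.rpow_mul hζ.le, ← Real.rpow_add hζ,
      ← Real.rpow_add hζ, dualPower]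
    congr 1
    ring
  rw [hpow, Nat.factorial_succ]
  have hα : (α : ℂ) ≠ 0 := by exact_mod_cast hζ.ne'
  have hMc : (M : ℂ) ≠ 0 := by exact_mod_cast hM.ne'
  have hNc : (N : ℂ) ≠ 0 := by exact_mod_cast hN.ne'
  have hk : (k.factorial : ℂ) ≠ 0 := by exact_mod_cast k.factorial_pos.ne'
  have hγc : (γ : ℂ) ≠ 0 := by exact_mod_cast hγ0.ne'
  have hπ : (Real.pi : ℂ) ≠ 0 := by exact_mod_cast Real.pi_ne_zero
  simp only [Complex.ofReal_mul, Complex.ofReal_div, Complex.ofReal_pow, Complex.ofReal_natCast,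
    Complex.ofReal_ofNat, Nat.cast_mul, Nat.cast_succ, div_pow, mul_pow]
  field_simp
  ring

/-- Raising `ζ₂` by `iε` multiplies the frequency function by `e^{-εξ}`, so boundary limits become
limits of dampings. -/
theorem synth_eq_integral_probe {k : ℕ} {ζ : surface γ} (hζ : 0 < ‖ζ.1.1‖) (ε : ℝ) (h : ℝ → ℂ) :
    synth γ r k 1 k (fun ξ => Real.exp (-(ε * ξ)) * h ξ) ζ
      = ∫ ξ, (starRingEnd ℂ) (probe γ r (ζ.1.1, ζ.1.2 + Complex.I * ε) k ξ) * h ξ ∂halfLine := by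
  rw [synth, ← integral_const_mul]
  congr 1
  ext ξ
  have h2 : ζ.1.2 = ζ.1.2.re + ((‖ζ.1.1‖ ^ γ : ℝ) : ℂ) * Complex.I := by
    have h3 : ζ.1.2.im = ‖ζ.1.1‖ ^ γ := ζ.2
    rw [← h3, Complex.re_add_im]
  have hα : (‖ζ.1.1‖ : ℂ) ≠ 0 := by exact_mod_cast hζ.ne'
  have e2 : Complex.exp (Complex.I * (ζ.1.2 + Complex.I * ε) * ξ) =
      ((Real.exp (-(1 * ξ * ‖ζ.1.1‖ ^ γ)) : ℝ) : ℂ) * ((Real.exp (-(ε * ξ)) : ℝ) : ℂ)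
      * Complex.exp (Complex.I * ξ * ζ.1.2.re) := by
    rw [Complex.ofReal_exp, Complex.ofReal_exp, ← Complex.exp_add, ← Complex.exp_add]
    congr 1
    simp only [Complex.ofReal_mul, Complex.ofReal_neg, Complex.ofReal_one]
    linear_combination (Complex.I * ξ) * h2 +
      (((‖ζ.1.1‖ ^ γ : ℝ) : ℂ) * ξ + ε * ξ) * Complex.I_mul_I
  rw [probe, profile]
  simp only [map_mul, map_pow, map_inv₀, Complex.conj_ofReal, Complex.conj_conj, ← Complex.exp_conj,
    map_neg, Complex.conj_I, neg_mul, neg_neg]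
  rw [e2, zpow_natCast, div_pow, Real.rpow_natCast]
  simp only [Complex.ofReal_mul, Complex.ofReal_pow]
  field_simp

end

/-! ### Convergence of the Leray integral -/

section

open scoped InnerProductSpace

variable {γ r : ℝ}

theorem measurable_denomA (γ : ℝ) (w : ℂ) : Measurable (denomA γ w) := by
  unfold denomA; fun_prop

theorem measurable_denomB (γ : ℝ) (w : ℂ) : Measurable (denomB γ w) := by
  unfold denomB
  have : Measurable fun ζ : surface γ => (starRingEnd ℂ) ζ.1.1 :=
    Complex.continuous_conj.measurable.comp (by fun_prop)
  fun_prop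

theorem measurable_kernelTerm (γ r : ℝ) (z : ℂ × ℂ) (k : ℕ) : Measurable (kernelTerm γ r z k) := by
  unfold kernelTerm
  have h1 := measurable_denomA γ z.2
  have h2 := measurable_denomB γ z.1
  fun_prop

theorem kernelTerm_ae_eq (hγ : 1 < γ) (hr : r ∈ Set.Ioo (-1 : ℝ) (2 * γ - 1)) {z : ℂ × ℂ}
    (hz : 0 < z.2.im) (k : ℕ) : kernelTerm γ r z k =ᵐ[mu γ r] fun ζ => ((pairCoeff γ r k : ℂ))⁻¹ *
      (starRingEnd ℂ) (synth γ r (dualPower γ r k) (γ - 1) k (probe γ r z k) ζ) :=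
  (ae_mu_pos γ r).mono fun _ hζ => (inv_pairCoeff_mul_conj_synth_probe hγ hr hz k hζ).symm

theorem memLp_kernelTerm (hγ : 1 < γ) (hr : r ∈ Set.Ioo (-1 : ℝ) (2 * γ - 1)) {z : ℂ × ℂ}
    (hz : 0 < z.2.im) (k : ℕ) : MemLp (kernelTerm γ r z k) 2 (mu γ r) :=
  (memLp_congr_ae (kernelTerm_ae_eq hγ hr hz k)).2 ((memLp_synth hγ (admissible_right hγ hr.2 k)
    (sub_pos.2 hγ) (memLp_probe hγ hr.1 hz k)).star.const_mul _)

theorem integral_mul_kernelTerm (hγ : 1 < γ) (hr : r ∈ Set.Ioo (-1 : ℝ) (2 * γ - 1)) {z : ℂ × ℂ}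
    (hz : 0 < z.2.im) (k : ℕ) (f : L2 γ r) :
    ∫ ζ, f ζ * kernelTerm γ r z k ζ ∂(mu γ r)
      = ∫ ξ, (starRingEnd ℂ) (probe γ r z k ξ) * (isBiorthogonal hγ hr).coeff f k ξ ∂halfLine := by
  set g : Freq := (memLp_probe hγ hr.1 hz k).toLp _
  have hg : g =ᵐ[halfLine] probe γ r z k := (memLp_probe hγ hr.1 hz k).coeFn_toLp
  have h1 : ∫ ζ, f ζ * kernelTerm γ r z k ζ ∂(mu γ r)
      = ((pairCoeff γ r k : ℂ))⁻¹ * ⟪embRight hγ hr k g, f⟫_ℂ := by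
    rw [L2.inner_def, ← integral_const_mul]
    apply integral_congr_ae
    filter_upwards [kernelTerm_ae_eq hγ hr hz k,
      coeFn_synthₗᵢ hγ (admissible_right hγ hr.2 k) (sub_pos.2 hγ) k g] with ζ e1 e2
    rw [e1, embRight, e2, synth_congr hg, RCLike.inner_apply]
    ring
  have h2 : ⟪g, (isBiorthogonal hγ hr).coeff f k⟫_ℂ
      = ((pairCoeff γ r k : ℂ))⁻¹ * ⟪embRight hγ hr k g, f⟫_ℂ := by
    rw [IsBiorthogonal.coeff_apply, inner_smul_right, ContinuousLinearMap.adjoint_inner_right]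
    rfl
  rw [h1, ← h2, L2.inner_def]
  apply integral_congr_ae
  filter_upwards [hg] with ξ e
  rw [e, RCLike.inner_apply, mul_comm]

/-- Pointwise expansion of the Leray kernel, with a summable majorant. -/
theorem hasSum_kernelTerm (hγ : 1 < γ) {z : ℂ × ℂ} (hz : z ∈ domain γ) :
    ∃ C, ∀ ζ : surface γ, 0 < ‖ζ.1.1‖ →
      HasSum (fun k => kernelTerm γ r z k ζ)
        (((‖ζ.1.1‖ ^ (γ - 1 - r) : ℝ) : ℂ) * kernel γ z ζ) ∧
      Summable (fun k => ‖kernelTerm γ r z k ζ‖) ∧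
      ∑' k, ‖kernelTerm γ r z k ζ‖ ≤ C * ‖kernelTerm γ r z 0 ζ‖ := by
  obtain ⟨c, hc0, hc1, hc⟩ := exists_denom_le hγ hz
  -- The series of norms sums to a multiple of `(‖A‖ - ‖B‖)⁻²`, and `‖A‖ - ‖B‖ ≥ (1-c)‖A‖`; the `k =
  -- 0` term carries `‖A‖⁻²`.
  refine ⟨((1 - c) ^ 2)⁻¹, fun ζ hζ => ?_⟩
  have hA := re_denomA_pos hγ (im_pos_of_mem_domain hz) ζ
  have hA' : 0 < ‖denomA γ z.2 ζ‖ := hA.trans_le (Complex.re_le_norm _)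
  have hle := hc ζ hζ
  have hlt : ‖denomB γ z.1 ζ‖ < ‖denomA γ z.2 ζ‖ := by nlinarith
  have h1 := (hasSum_inv_sub_sq hlt).mul_left (((‖ζ.1.1‖ ^ (γ - 1 - r) : ℝ) : ℂ) *
    ((γ ^ 2 / (4 * Real.pi ^ 2) : ℝ) : ℂ))
  have h2 := (hasSum_norm_inv_sub_sq hlt).mul_left ‖((‖ζ.1.1‖ ^ (γ - 1 - r) : ℝ) : ℂ) *
    ((γ ^ 2 / (4 * Real.pi ^ 2) : ℝ) : ℂ)‖
  have e2 : ∀ k, ‖kernelTerm γ r z k ζ‖ = ‖((‖ζ.1.1‖ ^ (γ - 1 - r) : ℝ) : ℂ) *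
      ((γ ^ 2 / (4 * Real.pi ^ 2) : ℝ) : ℂ)‖ *
      ‖((k : ℂ) + 1) * denomB γ z.1 ζ ^ k / denomA γ z.2 ζ ^ (k + 2)‖ := by
    intro k
    rw [kernelTerm, ← mul_assoc, norm_mul]
  simp only [← e2] at h2
  refine ⟨?_, h2.summable, ?_⟩
  · rw [kernel_eq z hζ]
    have e1 : ∀ k, kernelTerm γ r z k ζ = ((‖ζ.1.1‖ ^ (γ - 1 - r) : ℝ) : ℂ) *
        ((γ ^ 2 / (4 * Real.pi ^ 2) : ℝ) : ℂ) *
        (((k : ℂ) + 1) * denomB γ z.1 ζ ^ k / denomA γ z.2 ζ ^ (k + 2)) := by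
      intro k
      rw [kernelTerm, ← mul_assoc]
    simp only [e1]
    rw [mul_assoc, mul_one_div] at h1
    exact h1
  · rw [h2.tsum_eq, e2 0]
    set K := ‖((‖ζ.1.1‖ ^ (γ - 1 - r) : ℝ) : ℂ) * ((γ ^ 2 / (4 * Real.pi ^ 2) : ℝ) : ℂ)‖
    have h3 : (1 - c) * ‖denomA γ z.2 ζ‖ ≤ ‖denomA γ z.2 ζ‖ - ‖denomB γ z.1 ζ‖ := by linarith
    have h4 : 0 < (1 - c) * ‖denomA γ z.2 ζ‖ := mul_pos (by linarith) hA'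
    have hK : 0 ≤ K := norm_nonneg _
    calc K * (1 / (‖denomA γ z.2 ζ‖ - ‖denomB γ z.1 ζ‖) ^ 2)
        ≤ K * (1 / ((1 - c) * ‖denomA γ z.2 ζ‖) ^ 2) := by gcongr
      _ = _ := by
        simp only [Nat.cast_zero, zero_add, pow_zero, mul_one, norm_div, norm_one, norm_pow]
        rw [mul_pow, one_div, mul_inv]
        ring

/-- Dominated convergence: the majorant is a constant times `|f|` times the `k = 0` kernel term, a
product of two functions in `L²(μ_r)`. The same majorant gives absolute convergence. -/
theorem hasSum_lerayIntegral (hγ : 1 < γ) (hr : r ∈ Set.Ioo (-1 : ℝ) (2 * γ - 1)) {z : ℂ × ℂ}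
    (hz : z ∈ domain γ) (f : L2 γ r) :
    Integrable (fun ζ => f ζ * kernel γ z ζ) (mu γ (γ - 1)) ∧
    HasSum (fun k => ∫ ξ, (starRingEnd ℂ) (probe γ r z k ξ) *
      (isBiorthogonal hγ hr).coeff f k ξ ∂halfLine) (lerayIntegral γ f z) := by
  obtain ⟨C, hC⟩ := hasSum_kernelTerm (r := r) hγ hz
  have hy := im_pos_of_mem_domain hz
  have hF : ∀ k, AEStronglyMeasurable (fun ζ => f ζ * kernelTerm γ r z k ζ) (mu γ r) := fun k =>
    (Lp.aestronglyMeasurable f).mul (measurable_kernelTerm γ r z k).aestronglyMeasurable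
  have hmaj : Integrable (fun ζ => C * ‖f ζ * kernelTerm γ r z 0 ζ‖) (mu γ r) :=
    (((Lp.memLp f).integrable_mul (memLp_kernelTerm hγ hr hy 0)).norm).const_mul C
  have htsum : ∀ ζ : surface γ, ∑' k, ‖f ζ * kernelTerm γ r z k ζ‖
      = ‖f ζ‖ * ∑' k, ‖kernelTerm γ r z k ζ‖ := by
    intro ζ
    simp_rw [norm_mul]
    exact tsum_mul_left
  have hle : ∀ᵐ ζ ∂(mu γ r), ∑' k, ‖f ζ * kernelTerm γ r z k ζ‖
      ≤ C * ‖f ζ * kernelTerm γ r z 0 ζ‖ := by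
    filter_upwards [ae_mu_pos γ r] with ζ hζ
    rw [htsum, norm_mul, mul_left_comm]
    exact mul_le_mul_of_nonneg_left (hC ζ hζ).2.2 (norm_nonneg _)
  have hmeas : AEStronglyMeasurable (fun ζ => ∑' k, ‖f ζ * kernelTerm γ r z k ζ‖) (mu γ r) := by
    have hm : Measurable fun ζ => ∑' k, ‖f ζ * kernelTerm γ r z k ζ‖ := by
      refine Measurable.tsum fun k => ?_
      exact ((Lp.stronglyMeasurable f).measurable.mul (measurable_kernelTerm γ r z k)).norm
    exact hm.aestronglyMeasurable
  have hbi : Integrable (fun ζ => ∑' k, ‖f ζ * kernelTerm γ r z k ζ‖) (mu γ r) := by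
    refine hmaj.mono' hmeas (hle.mono fun ζ h => ?_)
    rwa [Real.norm_of_nonneg (tsum_nonneg fun _ => norm_nonneg _)]
  have hlim : ∀ᵐ ζ ∂(mu γ r), HasSum (fun k => f ζ * kernelTerm γ r z k ζ)
      (((‖ζ.1.1‖ ^ (γ - 1 - r) : ℝ) : ℂ) * (f ζ * kernel γ z ζ)) := by
    filter_upwards [ae_mu_pos γ r] with ζ hζ
    rw [mul_left_comm]
    exact (hC ζ hζ).1.mul_left _
  constructor
  · rw [integrable_sigma_iff γ r]
    have hk : Measurable (kernel γ z) := by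
      unfold kernel
      have : Measurable fun ζ : surface γ => (starRingEnd ℂ) ζ.1.1 :=
        Complex.continuous_conj.measurable.comp (by fun_prop)
      fun_prop
    have hm : AEStronglyMeasurable (fun ζ : surface γ => ((‖ζ.1.1‖ ^ (γ - 1 - r) : ℝ) : ℂ)
        * (f ζ * kernel γ z ζ)) (mu γ r) := by
      have h1 : Measurable fun ζ : surface γ => ((‖ζ.1.1‖ ^ (γ - 1 - r) : ℝ) : ℂ) := by fun_prop
      exact (h1.mul ((Lp.stronglyMeasurable f).measurable.mul hk)).aestronglyMeasurable
    refine hbi.mono' hm ?_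
    filter_upwards [hlim, ae_mu_pos γ r] with ζ h hζ
    have hs : Summable fun k => ‖f ζ * kernelTerm γ r z k ζ‖ := by
      simp_rw [norm_mul]
      exact (hC ζ hζ).2.1.mul_left _
    rw [← h.tsum_eq]
    exact norm_tsum_le_tsum_norm hs
  · rw [lerayIntegral, integral_sigma γ r]
    simp_rw [← integral_mul_kernelTerm hγ hr hy]
    refine hasSum_integral_of_dominated_convergence
      (fun k ζ => ‖f ζ * kernelTerm γ r z k ζ‖) hF (fun k => ae_of_all _ fun ζ => le_rfl) ?_ hbi hlim
    filter_upwards [ae_mu_pos γ r] with ζ hζ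
    simp_rw [norm_mul]
    exact (hC ζ hζ).2.1.mul_left _

theorem memLp_damp {ε : ℝ} (hε : 0 ≤ ε) {g : ℝ → ℂ} (hg : MemLp g 2 halfLine) :
    MemLp (fun ξ => (Real.exp (-(ε * ξ)) : ℂ) * g ξ) 2 halfLine := by
  refine MemLp.of_le hg ?_ ((ae_restrict_mem measurableSet_Ioi).mono fun ξ hξ => ?_)
  · exact AEStronglyMeasurable.mul (by fun_prop) hg.1
  · have hξ' : 0 < ξ := hξ
    rw [norm_mul, Complex.norm_real, Real.norm_of_nonneg (Real.exp_pos _).le]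
    exact mul_le_of_le_one_left (norm_nonneg _) (Real.exp_le_one_iff.2 (by
      have := mul_nonneg hε hξ'.le
      linarith))

/-- The function `e^{-εξ} g(ξ)`, as an element of `L²`. -/
def damp {ε : ℝ} (hε : 0 ≤ ε) (g : Freq) : Freq := (memLp_damp hε (Lp.memLp g)).toLp _

theorem coeFn_damp {ε : ℝ} (hε : 0 ≤ ε) (g : Freq) :
    damp hε g =ᵐ[halfLine] fun ξ => (Real.exp (-(ε * ξ)) : ℂ) * g ξ :=
  (memLp_damp hε (Lp.memLp g)).coeFn_toLp

theorem norm_damp_sub_le {ε : ℝ} (hε : 0 ≤ ε) (g : Freq) : ‖damp hε g - g‖ ≤ ‖g‖ := by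
  refine Lp.norm_le_norm_of_ae_le ?_
  filter_upwards [Lp.coeFn_sub (damp hε g) g, coeFn_damp hε g,
    ae_restrict_mem measurableSet_Ioi] with ξ h1 h2 hξ
  have hξ' : 0 < ξ := hξ
  have h3 : Real.exp (-(ε * ξ)) ≤ 1 := Real.exp_le_one_iff.2 (by
      have := mul_nonneg hε hξ'.le
      linarith)
  have h4 := Real.exp_pos (-(ε * ξ))
  rw [h1, Pi.sub_apply, h2, ← sub_one_mul, norm_mul, ← Complex.ofReal_one, ← Complex.ofReal_sub,
    Complex.norm_real, Real.norm_eq_abs]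
  exact mul_le_of_le_one_left (norm_nonneg _) (abs_le.2 ⟨by linarith, by linarith⟩)

theorem norm_sq_eq_integral (g : Freq) : ‖g‖ ^ 2 = ∫ ξ, ‖g ξ‖ ^ 2 ∂halfLine := by
  have h := L2.inner_def (𝕜 := ℂ) g g
  simp_rw [inner_self_eq_norm_sq_to_K] at h
  have e : ∫ ξ, ((‖g ξ‖ : ℂ)) ^ 2 ∂halfLine = ((∫ ξ, ‖g ξ‖ ^ 2 ∂halfLine : ℝ) : ℂ) := by
    rw [← integral_complex_ofReal]
    push_cast
    rfl
  apply Complex.ofReal_injective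
  rw [Complex.ofReal_pow]
  exact h.trans e

/-- Damping by `max ε 0`, to have a total function of `ε`. -/
def dampPos (ε : ℝ) (g : Freq) : Freq := damp (le_max_right ε 0) g

theorem tendsto_dampPos (g : Freq) :
    Tendsto (fun ε : ℝ => ‖dampPos ε g - g‖ ^ 2) (𝓝[>] 0) (𝓝 0) := by
  have hsub : ∀ ε : ℝ, ‖dampPos ε g - g‖ ^ 2
      = ∫ ξ, (Real.exp (-(max ε 0 * ξ)) - 1) ^ 2 * ‖g ξ‖ ^ 2 ∂halfLine := by
    intro ε
    rw [norm_sq_eq_integral]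
    apply integral_congr_ae
    filter_upwards [Lp.coeFn_sub (dampPos ε g) g, coeFn_damp (le_max_right ε 0) g] with ξ h1 h2
    rw [h1, Pi.sub_apply, dampPos, h2, ← sub_one_mul, ← Complex.ofReal_one, ← Complex.ofReal_sub,
      norm_mul, mul_pow, Complex.norm_real, Real.norm_eq_abs, sq_abs]
  simp_rw [hsub]
  suffices h : Tendsto (fun ε : ℝ => ∫ ξ, (Real.exp (-(max ε 0 * ξ)) - 1) ^ 2 * ‖g ξ‖ ^ 2 ∂halfLine)
      (𝓝[>] 0) (𝓝 (∫ _, (0 : ℝ) ∂halfLine)) by simpa using h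
  refine tendsto_integral_filter_of_dominated_convergence (fun ξ => ‖g ξ‖ ^ 2) ?_ ?_ ?_ ?_
  · refine Eventually.of_forall fun ε => ?_
    exact AEStronglyMeasurable.mul (by fun_prop) ((Lp.aestronglyMeasurable g).norm.pow 2)
  · refine Eventually.of_forall fun ε => ?_
    filter_upwards [ae_restrict_mem measurableSet_Ioi] with ξ hξ
    have hξ' : 0 < ξ := hξ
    have h3 : Real.exp (-(max ε 0 * ξ)) ≤ 1 := Real.exp_le_one_iff.2 (by
      have := mul_nonneg (le_max_right ε 0) hξ'.le
      linarith)
    have h4 := Real.exp_pos (-(max ε 0 * ξ))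
    rw [Real.norm_of_nonneg (by positivity)]
    exact mul_le_of_le_one_left (by positivity) (by nlinarith)
  · exact (memLp_two_iff_integrable_sq_norm (Lp.aestronglyMeasurable g)).1 (Lp.memLp g)
  · refine ae_of_all _ fun ξ => ?_
    have hc : Continuous fun ε : ℝ => (Real.exp (-(max ε 0 * ξ)) - 1) ^ 2 * ‖g ξ‖ ^ 2 := by
      fun_prop
    exact (hc.tendsto' 0 0 (by simp)).mono_left nhdsWithin_le_nhds

end

/-! ### The boundary values of the Leray integral -/

section

open scoped InnerProductSpace

variable {γ r : ℝ}

theorem norm_sq_eq_tsum (x : lp (fun _ : ℕ => Freq) 2) : ‖x‖ ^ 2 = ∑' k, ‖x k‖ ^ 2 := by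
  have := lp.norm_rpow_eq_tsum (p := 2) (by norm_num) x
  simpa using this

theorem summable_norm_sq (x : lp (fun _ : ℕ => Freq) 2) : Summable fun k => ‖x k‖ ^ 2 := by
  have := (lp.memℓp x).summable (by norm_num)
  simpa using this

/-- Componentwise damping of a square-summable sequence. -/
def dampSeq (ε : ℝ) (x : lp (fun _ : ℕ => Freq) 2) : lp (fun _ : ℕ => Freq) 2 :=
  ⟨fun k => dampPos ε (x k), by
    have h : Memℓp (fun k => dampPos ε (x k) - x k) 2 := by
      refine memℓp_gen ?_
      refine Summable.of_nonneg_of_le (fun k => by positivity) (fun k => ?_) (summable_norm_sq x)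
      have hk : ‖dampPos ε (x k) - x k‖ ≤ ‖x k‖ := norm_damp_sub_le (le_max_right ε 0) (x k)
      simpa using pow_le_pow_left₀ (norm_nonneg _) hk 2
    have e : (fun k => dampPos ε (x k) - x k) + (x : ℕ → Freq) = fun k => dampPos ε (x k) := by
      ext1 k
      simp
    exact e ▸ h.add (lp.memℓp x)⟩

/-- Dominated convergence of the series of squared norms, since each component moves by at most its
own norm. -/
theorem tendsto_dampSeq (x : lp (fun _ : ℕ => Freq) 2) :
    Tendsto (fun ε : ℝ => dampSeq ε x) (𝓝[>] 0) (𝓝 x) := by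
  have h : Tendsto (fun ε : ℝ => ‖dampSeq ε x - x‖ ^ 2) (𝓝[>] 0) (𝓝 0) := by
    simp_rw [norm_sq_eq_tsum]
    suffices h : Tendsto (fun ε : ℝ => ∑' k, ‖(dampSeq ε x - x) k‖ ^ 2) (𝓝[>] 0)
        (𝓝 (∑' _ : ℕ, (0 : ℝ))) by simpa using h
    refine tendsto_tsum_of_dominated_convergence (bound := fun k => ‖x k‖ ^ 2)
      (summable_norm_sq x) (fun k => tendsto_dampPos (x k)) (Eventually.of_forall fun ε k => ?_)
    rw [Real.norm_of_nonneg (by positivity)]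
    exact pow_le_pow_left₀ (norm_nonneg _) (norm_damp_sub_le (le_max_right ε 0) (x k)) 2
  rw [tendsto_iff_norm_sub_tendsto_zero]
  have h2 := h.sqrt
  simpa [Real.sqrt_sq (norm_nonneg _)] using h2

theorem mem_domain_translate {ε : ℝ} (hε : 0 < ε) (ζ : surface γ) :
    (ζ.1.1, ζ.1.2 + Complex.I * ε) ∈ domain γ := by
  have h3 : ζ.1.2.im = ‖ζ.1.1‖ ^ γ := ζ.2
  change ‖ζ.1.1‖ ^ γ < (ζ.1.2 + Complex.I * ε).im
  simp [h3, hε]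

/-- Both sides are limits of the same partial sums, one pointwise and one in `L²`; they are compared
along an almost everywhere convergent subsequence. -/
theorem lerayIntegral_translate (hγ : 1 < γ) (hr : r ∈ Set.Ioo (-1 : ℝ) (2 * γ - 1)) {ε : ℝ}
    (hε : 0 < ε) (f : L2 γ r) :
    (fun ζ : surface γ => lerayIntegral γ f (ζ.1.1, ζ.1.2 + Complex.I * (ε : ℂ))) =ᵐ[mu γ r]
      (isBiorthogonal hγ hr).left.linearIsometry
        (dampSeq ε ((isBiorthogonal hγ hr).coeff f)) := by
  set x := dampSeq ε ((isBiorthogonal hγ hr).coeff f) with hx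
  have hs := ((isBiorthogonal hγ hr).left.hasSum_linearIsometry x).tendsto_sum_nat
  obtain ⟨ns, hns, hae⟩ := (tendstoInMeasure_of_tendsto_Lp hs).exists_seq_tendsto_ae
  have hfin : ∀ n, (∑ k ∈ Finset.range n, embLeft hγ hr k (x k) : L2 γ r)
      =ᵐ[mu γ r] fun ζ => ∑ k ∈ Finset.range n, synth γ r k 1 k (x k) ζ := by
    intro n
    have h1 : ∀ᵐ ζ ∂(mu γ r), ∀ k : ℕ, embLeft hγ hr k (x k) ζ = synth γ r k 1 k (x k) ζ :=
      ae_all_iff.2 fun k => coeFn_synthₗᵢ hγ (admissible_left hr.1 k) one_pos k (x k)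
    filter_upwards [h1, Lp.coeFn_finsetSum (Finset.range n) fun k => embLeft hγ hr k (x k)]
      with ζ e1 e2
    rw [e2, Finset.sum_apply]
    exact Finset.sum_congr rfl fun k _ => e1 k
  filter_upwards [hae, ae_all_iff.2 hfin, ae_mu_pos γ r] with ζ h1 h2 hζ
  have hL := (hasSum_lerayIntegral hγ hr (mem_domain_translate hε ζ) f).2.tendsto_sum_nat
  have hL' := hL.comp hns.tendsto_atTop
  refine tendsto_nhds_unique hL' (h1.congr fun i => ?_)
  rw [h2]
  refine Finset.sum_congr rfl fun k _ => ?_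
  rw [← synth_eq_integral_probe hζ ε]
  have : (x k : Freq) =ᵐ[halfLine] fun ξ =>
      (Real.exp (-(ε * ξ)) : ℂ) * (isBiorthogonal hγ hr).coeff f k ξ := by
    refine (coeFn_damp (le_max_right ε 0) ((isBiorthogonal hγ hr).coeff f k)).trans
      (ae_of_all _ fun ξ => ?_)
    simp only
    rw [max_eq_left hε.le]
  rw [synth_congr this]

/-- Translates are the isometric images of damped coefficient sequences, so they converge in `L²` to
the image of the undamped sequence, which is `proj f`. -/
theorem isLerayTransform (hγ : 1 < γ) (hr : r ∈ Set.Ioo (-1 : ℝ) (2 * γ - 1)) :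
    IsLerayTransform γ r (isBiorthogonal hγ hr).proj where
  integrable f z hz := (hasSum_lerayIntegral hγ hr hz f).1
  tendsto f := by
    set W := (isBiorthogonal hγ hr).left.linearIsometry
    set x := (isBiorthogonal hγ hr).coeff f
    have h1 : Tendsto (fun ε : ℝ => W (dampSeq ε x)) (𝓝[>] 0) (𝓝 (W x)) :=
      (W.continuous.tendsto x).comp (tendsto_dampSeq x)
    have h2 := (Lp.tendsto_Lp_iff_tendsto_eLpNorm' _ _).1 h1
    refine h2.congr' ?_
    filter_upwards [self_mem_nhdsWithin] with ε hε
    apply eLpNorm_congr_ae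
    filter_upwards [lerayIntegral_translate hγ hr hε f] with ζ h
    rw [IsBiorthogonal.proj_apply]
    exact congrArg (· - _) h.symm

theorem sq_eq_one_sub_iff (hγ : 1 < γ) (hr : r ∈ Set.Ioo (-1 : ℝ) (2 * γ - 1)) (k : ℕ)
    (hk : 1 ≤ symbol γ r k) (c : ℂ) :
    c ^ 2 = 1 - ((pairCoeff γ r k : ℂ)⁻¹) ^ 2 ↔
      (c = Complex.I * (Real.sqrt (symbol γ r k - 1) : ℂ) ∨
        c = -(Complex.I * (Real.sqrt (symbol γ r k - 1) : ℂ))) := by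
  have h : 1 - ((pairCoeff γ r k : ℂ)⁻¹) ^ 2
      = (Complex.I * (Real.sqrt (symbol γ r k - 1) : ℂ)) ^ 2 := by
    rw [mul_pow, Complex.I_sq, ← Complex.ofReal_pow, Real.sq_sqrt (by linarith),
      ← inv_pairCoeff_sq hγ hr]
    push_cast
    ring
  rw [h, sq_eq_sq_iff_eq_or_eq_neg]

end

end Leray

end

/-! ### The spectrum of the skew part of the Leray transform -/

theorem theorem1p5 (γ r : ℝ) (hγ : 1 < γ) (hr : r ∈ Set.Ioo (-1 : ℝ) (2 * γ - 1)) :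
    (∀ k : ℕ, 1 ≤ Leray.symbol γ r k) ∧
    ∃ L : Leray.L2 γ r →L[ℂ] Leray.L2 γ r, Leray.IsLerayTransform γ r L ∧
      ∃ A : Leray.L2 γ r →L[ℂ] Leray.L2 γ r, A = ContinuousLinearMap.adjoint L - L ∧
        (∃ (ι : Type) (b : HilbertBasis ι ℂ (Leray.L2 γ r)),
          ∀ i, ∃ c : ℂ, A (b i) = c • b i) ∧
        {c : ℂ | Module.End.HasEigenvalue (A : Leray.L2 γ r →ₗ[ℂ] Leray.L2 γ r) c}
          = Leray.eigenvalueSet γ r ∧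
        spectrum ℂ A = closure (Leray.eigenvalueSet γ r) := by
  have h := Leray.isBiorthogonal hγ hr
  have hsymb : ∀ k : ℕ, 1 ≤ Leray.symbol γ r k := by
    intro k
    rw [← Leray.inv_pairCoeff_sq hγ hr]
    exact one_le_pow₀ (h.one_le_inv k)
  have heig : {c : ℂ | Module.End.HasEigenvalue (h.skew : Leray.L2 γ r →ₗ[ℂ] Leray.L2 γ r) c}
      = Leray.eigenvalueSet γ r := by
    rw [h.eigenvalues_skew (Leray.exists_orthogonal hγ hr), Leray.eigenvalueSet]
    congr 1
    ext c
    exact exists_congr fun k => Leray.sq_eq_one_sub_iff hγ hr k (hsymb k) c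
  obtain ⟨ι, b, hb⟩ := h.exists_hilbertBasis_skew
  refine ⟨hsymb, h.proj, Leray.isLerayTransform hγ hr, h.skew, rfl, ⟨ι, b, hb⟩, heig, ?_⟩
  rw [← heig]
  exact Leray.spectrum_of_skew h.adjoint_skew b hb
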